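/- Let $d\ge 1$ be an integer, let $\mathbb S^d\subset\mathbb R^{d+1}$ be the unit sphere with normalized surface area measure $\sigma_d$, North Pole $p=(0,\dots,0,1)$ and South Pole $-p$, and let $d-1<s<d$. Put $$W=W_s(\mathbb S^d)=\inf_\mu\iint |x-y|^{-s}\,d\mu(x)\,d\mu(y),$$ the infimum over Borel probability measures $\mu$ on $\mathbb S^d$, and for $R\ge 0$ $$U(R)=\int_{\mathbb S^d}|Rp-y|^{-s}\,d\sigma_d(y),\qquad f(R)=\frac{|R-1|^{d-s}}{(R+1)^d}-U(R).$$ For $q<0$ and $0\le R<1$ consider the external field $Q(x)=q/|x-Rp|^s$ on $\mathbb S^d$. A signed $s$-equilibrium on $\mathbb S^d$ associated with $Q$ is a finite signed Borel measure $\eta$ on $\mathbb S^d$ with $\eta(\mathbb S^d)=1$ for which $\int|x-y|^{-s}\,d\eta(y)+Q(x)$ converges absolutely and has the same value for every $x\in\mathbb S^d$. The Gonchar function of the fourth kind is $$D(R)=\frac{W}{q}(1+R)^d-(1-R)^{d-s}+(1+R)^dU(R).$$ A critical distance is an $R\in(0,1)\cup(1,\infty)$ with $W/q=f(R)$. Gonchar's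 problem (for the negative charge $q$ inside the sphere) asks for the distances $1-R$ from the North Pole to positions $Rp$, $0<R<1$, of the charge for which the continuous density of the signed $s$-equilibrium with respect to $\sigma_d$ is zero at the South Pole. Then $f$ is strictly decreasing on $(0,1)$ with $-W\le f\le 0$ there, and $f$ is neither convex nor concave on $(0,1)$. For every $q<0$ and $0\le R<1$ there is exactly one signed $s$-equilibrium $\eta$ associated with $Q$. Moreover: (i) If $-1\le q<0$, then for every $R\in(0,1)$ the measure $\eta$ is a positive measure with support $\mathbb S^d$; there is no critical distance in $(0,1)$, and Gonchar's problem has no solution. (ii) If $q<-1$, then $D$ has a unique zero $R_q$ in $(0,1)$; for $R\in(0,1)$ the signed measure $\eta$ is positive if and only if $R\le R_q$, and in that case its support is $\mathbb S^d$; $R_q$ is the only critical distance in $(0,1)$, and $1-R_q$ is the only solution of Gonchar's problem. (iii) If $q<0$ and $R=0$, then $\eta$ is a positive measure with support $\mathbb S^d$, and it does not have a continuous density with respect to $\sigma_d$ that is zero at the South Pole. -/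

import Mathlib

open MeasureTheory Set

namespace RieszSphere

/-- The Euclidean space `ℝ^{d+1}`. -/
abbrev Space (d : ℕ) : Type := EuclideanSpace ℝ (Fin (d + 1))

/-- The unit sphere `S^d` in `ℝ^{d+1}`, as a type. -/
abbrev Sph (d : ℕ) : Type := Metric.sphere (0 : Space d) 1

/-- The normalized (total mass one) surface area measure `σ_d` on `S^d`. -/
noncomputable def sigma (d : ℕ) : Measure (Sph d) :=
  ((volume : Measure (Space d)).toSphere univ)⁻¹ • (volume : Measure (Space d)).toSphere

/-- The unit vector on the positive polar (last coordinate) axis: the North Pole as a point of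
`ℝ^{d+1}`. -/
noncomputable def axis (d : ℕ) : Space d := EuclideanSpace.single (Fin.last d) 1

/-- The South Pole `-p` of `S^d`. -/
noncomputable def southPole (d : ℕ) : Sph d := ⟨-axis d, by simp [axis]⟩

/-- The Riesz `s`-potential `x ↦ ∫ |x - y|^{-s} dμ(y)` of a positive measure on the sphere, as an
extended nonnegative number (for `s > 0` the kernel is `∞` on the diagonal). -/
noncomputable def rieszPotential {d : ℕ} (s : ℝ) (μ : Measure (Sph d)) (x : Space d) : ENNReal :=
  ∫⁻ y : Sph d, edist x (y : Space d) ^ (-s) ∂μ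

/-- The Riesz `s`-energy `∫∫ |x - y|^{-s} dμ(y) dμ(x)`. -/
noncomputable def rieszEnergy {d : ℕ} (s : ℝ) (μ : Measure (Sph d)) : ENNReal :=
  ∫⁻ x : Sph d, rieszPotential s μ (x : Space d) ∂μ

/-- The Riesz `s`-energy `W_s(S^d)` of the sphere: the infimum of the energies of the Borel
probability measures on `S^d` (it is finite for `0 < s < d`). -/
noncomputable def W (d : ℕ) (s : ℝ) : ℝ :=
  (⨅ μ : ProbabilityMeasure (Sph d), rieszEnergy s (μ : Measure (Sph d))).toReal

/-- `U_s^{σ_d}(R)`: the potential of `σ_d` at the point at (signed) height `R` on the polar axis. -/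
noncomputable def U (d : ℕ) (s R : ℝ) : ℝ :=
  (rieszPotential s (sigma d) (R • axis d)).toReal

/-- The external field `Q(x) = q / |x - a|^s` on `S^d` of a charge `q` at `a = (0, R)`. -/
noncomputable def field (d : ℕ) (s q R : ℝ) (x : Sph d) : ℝ :=
  q / dist (x : Space d) (R • axis d) ^ s

/-- The Riesz `s`-potential of a signed measure on the sphere (meaningful where the potential of
the total variation is finite). -/
noncomputable def signedPotential {d : ℕ} (s : ℝ) (η : SignedMeasure (Sph d)) (x : Space d) : ℝ :=
  (rieszPotential s η.toJordanDecomposition.posPart x).toReal -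
    (rieszPotential s η.toJordanDecomposition.negPart x).toReal

/-- `η` is a signed `s`-equilibrium on `S^d` associated with the external field `Q`: it has total
charge one, and its weighted potential exists (the integral converges absolutely) and is the same
constant at every point of the sphere. -/
structure IsSignedEquilibrium {d : ℕ} (s : ℝ) (Q : Sph d → ℝ) (η : SignedMeasure (Sph d)) :
    Prop where
  total : η univ = 1
  finite : ∀ x : Sph d, rieszPotential s η.totalVariation (x : Space d) < ⊤
  const : ∃ G : ℝ, ∀ x : Sph d, signedPotential s η (x : Space d) + Q x = G

/-- The support of `η` (used for nonnegative `η`) is the whole sphere. -/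
def HasFullSupport {d : ℕ} (η : SignedMeasure (Sph d)) : Prop :=
  ∀ V : Set (Sph d), IsOpen V → V.Nonempty → 0 < η V

/-- `f(R) = |R - 1|^{d-s} / (R + 1)^d - U_s^{σ_d}(R)`. -/
noncomputable def f (d : ℕ) (s R : ℝ) : ℝ :=
  |R - 1| ^ ((d : ℝ) - s) / (R + 1) ^ d - U d s R

/-- The Gonchar function of the fourth kind. -/
noncomputable def goncharD (d : ℕ) (s q R : ℝ) : ℝ :=
  W d s / q * (1 + R) ^ d - (1 - R) ^ ((d : ℝ) - s) + (1 + R) ^ d * U d s R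

/-- `R` is a critical distance for the negative charge `q`: a solution in `(0,1) ∪ (1,∞)` of the
characteristic equation `W_s(S^d) / q = f(R)`. -/
def IsCriticalDistance (d : ℕ) (s q R : ℝ) : Prop :=
  R ∈ Ioo (0 : ℝ) 1 ∪ Ioi 1 ∧ W d s / q = f d s R

/-- The signed equilibrium for the charge `q` at `(0, R)` has a continuous density with respect
to `σ_d`, and this density is zero at the South Pole. -/
def DensityVanishesAtSouthPole (d : ℕ) (s q R : ℝ) : Prop :=
  ∃ h : Sph d → ℝ, Continuous h ∧
    IsSignedEquilibrium s (field d s q R) ((sigma d).withDensityᵥ h) ∧ h (southPole d) = 0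

/-- `ρ` solves Gonchar's problem for a negative charge `q` inside the sphere (and off its center):
`ρ` is the distance from the North Pole to a position `(0, R)`, `0 < R < 1`, of the charge for which
the density of the signed equilibrium is zero at the South Pole. -/
def IsGoncharSolution (d : ℕ) (s q ρ : ℝ) : Prop :=
  ∃ R ∈ Ioo (0 : ℝ) 1, ρ = dist (R • axis d) (axis d) ∧ DensityVanishesAtSouthPole d s q R

end RieszSphere

namespace RieszSphere

variable {d : ℕ}

open scoped RealInnerProductSpace

/-! The signed equilibrium is explicit. Sweeping a unit charge at `R • axis d` onto the sphere gives
a density proportional to `conf R (axis d) y ^ (s / 2 - d)`. Subtracting `q` times this balayage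
from a multiple of `sigma d` cancels the field, and the multiple is fixed by total charge one
(`isSignedEquilibrium_eqDensity`). As `q < 0`, for `R > 0` the density has its strict minimum at the
South Pole, where it equals `1 - q / W d s * f d s R`. So positivity means `W d s / q ≤ f d s R`,
and the rest is about `f`, which decreases strictly and continuously from `0` at `R = 0` to `-W d s`
at `R = 1`. The level `W d s / q` lies strictly between these values exactly when `q < -1`.

The balayage formula (`lintegral_kernel_conf`) comes from conformal invariance: a Möbius map of the
sphere is a Lorentz boost acting on the light cone, and a change of variables in `ℝ^{d+1}` yields
its Jacobian. The same substitution gives the symmetry `confInt_symm`, which with `d - 1 < s` makes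
`U` increasing. That `W d s = U d s 1`, i.e. that `sigma d` minimizes energy, follows by writing the
Riesz kernel as a superposition of Gaussians, each positive definite (`gaussEnergy_sigma_le`).

Uniqueness (`measure_eq_of_potential`) is obtained by pairing potentials with balayage densities:
this recovers the integrals of `(1 - u * ⟪e, y⟫) ^ (-(s / 2))`, hence all moments of `⟪e, y⟫`, hence
the characteristic function. -/

/-! ### Polar coordinates and change of variables on the sphere -/

lemma lintegral_polar (G : Space d → ENNReal) (hG : Measurable G) :
    ∫⁻ z, G z = ∫⁻ ω : Sph d, ∫⁻ r : Ioi (0 : ℝ), G (r.1 • (ω : Space d))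
      ∂(Measure.volumeIoiPow d) ∂(volume : Measure (Space d)).toSphere := by
  have h := (volume : Measure (Space d)).measurePreserving_homeomorphUnitSphereProd
  have hdim : Module.finrank ℝ (Space d) - 1 = d := by simp
  rw [hdim] at h
  have h1 : ∫⁻ z, G z = ∫⁻ z : ({(0)}ᶜ : Set (Space d)), G z.1 ∂(volume.comap Subtype.val) := by
    rw [lintegral_subtype_comap (measurableSet_singleton _).compl, restrict_compl_singleton]
  have hm : Measurable fun p : Sph d × Ioi (0 : ℝ) ↦ G (p.2.1 • (p.1 : Space d)) :=
    hG.comp (by fun_prop)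
  rw [h1, ← lintegral_prod _ hm.aemeasurable, ← h.lintegral_comp hm]
  refine lintegral_congr fun z ↦ ?_
  have hz : ‖z.1‖ ≠ 0 := norm_ne_zero_iff.2 z.2
  simp [smul_smul, hz]

/-- A positively homogeneous change of variables of `ℝ^{d+1}` induces one of the sphere. -/
lemma lintegral_toSphere_transfer {Φ : Space d → Space d} (hΦ : Measurable Φ)
    {J : Space d → ENNReal} (hJm : Measurable J)
    (hvol : ∀ G : Space d → ENNReal, Measurable G → ∫⁻ z, J z * G (Φ z) = ∫⁻ z, G z)
    (hhom : ∀ r : ℝ, 0 < r → ∀ z, Φ (r • z) = r • Φ z)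
    (hJ : ∀ r : ℝ, 0 < r → ∀ z, J (r • z) = J z)
    (hpos : ∀ z, z ≠ 0 → Φ z ≠ 0)
    {g : Space d → ENNReal} (hg : Measurable g) :
    ∫⁻ ω : Sph d, g ω ∂(volume : Measure (Space d)).toSphere =
      ∫⁻ ω : Sph d, J ω * ENNReal.ofReal (‖Φ ω‖⁻¹ ^ (d + 1)) * g (‖Φ ω‖⁻¹ • Φ ω)
        ∂(volume : Measure (Space d)).toSphere := by
  -- The integrand is extended by homogeneity of degree zero and cut off to the unit ball, so that
  -- the radial integral becomes a mere factor on each ray.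
  set G : Space d → ENNReal := fun z ↦ g (‖z‖⁻¹ • z) * (Iio (1 : ℝ)).indicator 1 ‖z‖ with hGdef
  have hG : Measurable G :=
    (hg.comp (by fun_prop)).mul ((measurable_one.indicator measurableSet_Iio).comp measurable_norm)
  have key := hvol G hG
  have hpol := lintegral_polar _ (hJm.mul (hG.comp hΦ))
  simp only [Pi.mul_apply, Function.comp_apply] at hpol
  rw [lintegral_polar _ hG, hpol] at key
  -- On a ray stretched by `c` the cutoff leaves `r < c⁻¹`, of `r ^ d dr`-mass `c⁻¹ ^ (d + 1) / (d +
  -- 1)`.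
  have hinner : ∀ c : ℝ, 0 < c → ∀ A : ENNReal,
      ∫⁻ r : Ioi (0 : ℝ), A * (Iio (1 : ℝ)).indicator 1 (r.1 * c) ∂(Measure.volumeIoiPow d) =
        A * ENNReal.ofReal (c⁻¹ ^ (d + 1)) * ENNReal.ofReal (1 / (d + 1)) := by
    intro c hc A
    have hm : Measurable fun r : Ioi (0 : ℝ) ↦
        (Iio (1 : ℝ)).indicator (1 : ℝ → ENNReal) (r.1 * c) :=
      (measurable_one.indicator measurableSet_Iio).comp (by fun_prop)
    rw [lintegral_const_mul _ hm, mul_assoc, ← ENNReal.ofReal_mul (by positivity)]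
    congr 1
    have h2 : (fun r : Ioi (0 : ℝ) ↦ (Iio (1 : ℝ)).indicator (1 : ℝ → ENNReal) (r.1 * c)) =
        (Iio (⟨c⁻¹, mem_Ioi.2 (inv_pos.2 hc)⟩ : Ioi (0 : ℝ))).indicator 1 := by
      funext r
      have : r.1 * c < 1 ↔ r < ⟨c⁻¹, mem_Ioi.2 (inv_pos.2 hc)⟩ := by
        rw [← lt_div_iff₀ hc, one_div]; rfl
      by_cases hr : r.1 * c < 1
      · rw [indicator_of_mem (by exact hr), indicator_of_mem (by exact this.1 hr)]; rfl
      · rw [indicator_of_notMem (by exact hr), indicator_of_notMem (by exact fun h ↦ hr (this.2 h))]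
    rw [h2, lintegral_indicator_one measurableSet_Iio, Measure.volumeIoiPow_apply_Iio]
    congr 1
    simp [div_eq_mul_inv]
  have hd0 : ENNReal.ofReal (1 / (d + 1)) ≠ 0 := by
    rw [Ne, ENNReal.ofReal_eq_zero, not_le]; positivity
  have hL : ∀ ω : Sph d, ∫⁻ r : Ioi (0 : ℝ), G (r.1 • (ω : Space d)) ∂(Measure.volumeIoiPow d) =
      g ω * ENNReal.ofReal (1 / (d + 1)) := by
    intro ω
    have h1 : ‖(ω : Space d)‖ = 1 := norm_eq_of_mem_sphere ω
    rw [show g ω * ENNReal.ofReal (1 / (d + 1)) = g ω * ENNReal.ofReal ((1 : ℝ)⁻¹ ^ (d + 1)) *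
      ENNReal.ofReal (1 / (d + 1)) by simp, ← hinner 1 one_pos]
    refine lintegral_congr fun r ↦ ?_
    have hr : (0 : ℝ) < r.1 := r.2
    simp only [hGdef, norm_smul, h1, mul_one, Real.norm_eq_abs, abs_of_pos hr, smul_smul,
      inv_mul_cancel₀ hr.ne', one_smul]
  have hR : ∀ ω : Sph d, ∫⁻ r : Ioi (0 : ℝ), J (r.1 • (ω : Space d)) * G (Φ (r.1 • (ω : Space d)))
      ∂(Measure.volumeIoiPow d) = J ω * ENNReal.ofReal (‖Φ ω‖⁻¹ ^ (d + 1)) * g (‖Φ ω‖⁻¹ • Φ ω) *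
        ENNReal.ofReal (1 / (d + 1)) := by
    intro ω
    have h1 : (ω : Space d) ≠ 0 := by
      rw [← norm_ne_zero_iff, norm_eq_of_mem_sphere ω]; exact one_ne_zero
    have h2 : 0 < ‖Φ ω‖ := norm_pos_iff.2 (hpos _ h1)
    rw [mul_right_comm (J ω), ← hinner _ h2]
    refine lintegral_congr fun r ↦ ?_
    have hr : (0 : ℝ) < r.1 := r.2
    have h3 : (r.1 * ‖Φ ω‖)⁻¹ * r.1 = ‖Φ ω‖⁻¹ := by field_simp
    simp only [hGdef, hhom _ hr, hJ _ hr, norm_smul, Real.norm_eq_abs, abs_of_pos hr, smul_smul, h3,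
      mul_assoc]
  have hm1 : Measurable fun ω : Sph d ↦ g ω := hg.comp measurable_subtype_coe
  have hm2 : Measurable fun ω : Sph d ↦
      J ω * ENNReal.ofReal (‖Φ ω‖⁻¹ ^ (d + 1)) * g (‖Φ ω‖⁻¹ • Φ ω) := by
    have : Measurable fun z : Space d ↦
        J z * ENNReal.ofReal (‖Φ z‖⁻¹ ^ (d + 1)) * g (‖Φ z‖⁻¹ • Φ z) :=
      (hJm.mul (by fun_prop)).mul (hg.comp (by fun_prop))
    exact this.comp measurable_subtype_coe
  simp only [hL, hR] at key
  rw [lintegral_mul_const _ hm1, lintegral_mul_const _ hm2] at key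
  exact ((ENNReal.mul_left_inj hd0 ENNReal.ofReal_ne_top).1 key).symm

lemma lintegral_sigma (g : Sph d → ENNReal) : ∫⁻ ω, g ω ∂(sigma d) =
    ((volume : Measure (Space d)).toSphere univ)⁻¹ *
      ∫⁻ ω, g ω ∂(volume : Measure (Space d)).toSphere := by
  rw [sigma, lintegral_smul_measure, smul_eq_mul]

lemma toSphere_univ_ne_zero : (volume : Measure (Space d)).toSphere univ ≠ 0 := by
  rw [Ne, Measure.measure_univ_eq_zero]; exact Measure.toSphere_ne_zero _

instance : IsProbabilityMeasure (sigma d) where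
  measure_univ := by
    rw [sigma, Measure.smul_apply, smul_eq_mul]
    exact ENNReal.inv_mul_cancel toSphere_univ_ne_zero (measure_ne_top _ _)

instance : (sigma d).IsOpenPosMeasure := by
  rw [sigma]
  exact Measure.isOpenPosMeasure_smul _ (ENNReal.inv_ne_zero.2 (measure_ne_top _ _))

lemma lintegral_sigma_isometry (L : Space d ≃ₗᵢ[ℝ] Space d) {g : Space d → ENNReal}
    (hg : Measurable g) : ∫⁻ ω : Sph d, g (L ω) ∂(sigma d) = ∫⁻ ω : Sph d, g ω ∂(sigma d) := by
  rw [lintegral_sigma, lintegral_sigma, lintegral_toSphere_transfer (Φ := L) (J := fun _ ↦ 1)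
    L.continuous.measurable measurable_const ?_ ?_ ?_ ?_ hg]
  · congr 1
    refine lintegral_congr fun ω ↦ ?_
    simp
  · intro G hG
    simpa using (L.measurePreserving.lintegral_comp hG)
  · intro r _ z; simp
  · intros; rfl
  · intro z hz; simpa using hz

/-! ### Lorentz boosts on the light cone -/

/-- A boost followed by a reflection, acting on the future light cone of `ℝ^{d+1,1}`, which is
parametrized by `z ↦ (z, ‖z‖)`. -/
noncomputable def boost (γ β : ℝ) (e z : Space d) : Space d :=
  z + (β * ‖z‖ - (γ + 1) * ⟪e, z⟫) • e

lemma measurable_boost (γ β : ℝ) (e : Space d) : Measurable (boost γ β e) := by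
  unfold boost; fun_prop

lemma boost_smul (γ β : ℝ) (e : Space d) {r : ℝ} (hr : 0 < r) (z : Space d) :
    boost γ β e (r • z) = r • boost γ β e z := by
  simp only [boost, norm_smul, Real.norm_eq_abs, abs_of_pos hr, inner_smul_right, smul_add,
    smul_smul]
  ring_nf

lemma inner_boost (γ β : ℝ) {e : Space d} (he : ‖e‖ = 1) (z : Space d) :
    ⟪e, boost γ β e z⟫ = β * ‖z‖ - γ * ⟪e, z⟫ := by
  simp only [boost, inner_add_right, inner_smul_right, real_inner_self_eq_norm_sq, he]
  ring

lemma abs_lt_of_hyperbola {γ β : ℝ} (hγ : 0 < γ) (h : γ ^ 2 = 1 + β ^ 2) : |β| < γ :=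
  abs_lt_of_sq_lt_sq (by linarith) hγ.le

lemma boost_factor_pos {γ β : ℝ} (hγ : 0 < γ) (h : γ ^ 2 = 1 + β ^ 2) {e : Space d}
    (he : ‖e‖ = 1) {z : Space d} (hz : z ≠ 0) : 0 < γ * ‖z‖ - β * ⟪e, z⟫ := by
  have h1 : |⟪e, z⟫| ≤ ‖z‖ := by simpa [he] using abs_real_inner_le_norm e z
  have h2 := abs_lt_of_hyperbola hγ h
  have h3 : 0 < ‖z‖ := norm_pos_iff.2 hz
  have h4 : β * ⟪e, z⟫ ≤ |β| * ‖z‖ :=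
    (le_abs_self _).trans (by rw [abs_mul]; gcongr)
  nlinarith

lemma norm_boost {γ β : ℝ} (hγ : 0 < γ) (h : γ ^ 2 = 1 + β ^ 2) {e : Space d}
    (he : ‖e‖ = 1) (z : Space d) : ‖boost γ β e z‖ = γ * ‖z‖ - β * ⟪e, z⟫ := by
  rcases eq_or_ne z 0 with rfl | hz
  · simp [boost]
  refine (sq_eq_sq₀ (norm_nonneg _) (boost_factor_pos hγ h he hz).le).1 ?_
  rw [← real_inner_self_eq_norm_sq]
  simp only [boost, inner_add_left, inner_add_right, inner_smul_right, inner_smul_left,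
    real_inner_self_eq_norm_sq, he, real_inner_comm e z, RCLike.conj_to_real]
  linear_combination (⟪e, z⟫ ^ 2 - ‖z‖ ^ 2) * h

lemma boost_ne_zero {γ β : ℝ} (hγ : 0 < γ) (h : γ ^ 2 = 1 + β ^ 2) {e : Space d}
    (he : ‖e‖ = 1) {z : Space d} (hz : z ≠ 0) : boost γ β e z ≠ 0 := by
  rw [← norm_pos_iff, norm_boost hγ h he]; exact boost_factor_pos hγ h he hz

lemma boost_boost {γ β : ℝ} (hγ : 0 < γ) (h : γ ^ 2 = 1 + β ^ 2) {e : Space d}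
    (he : ‖e‖ = 1) (z : Space d) : boost γ β e (boost γ β e z) = z := by
  conv_lhs => rw [boost, norm_boost hγ h he, inner_boost γ β he]
  rw [boost, add_assoc, ← add_smul]
  convert add_zero z
  rw [smul_eq_zero]
  left
  linear_combination ⟪e, z⟫ * h

lemma hasFDerivAt_boost (γ β : ℝ) (e : Space d) {z : Space d} (hz : z ≠ 0) :
    HasFDerivAt (boost γ β e) (ContinuousLinearMap.id ℝ (Space d) +
      (β • (‖z‖⁻¹ • innerSL ℝ z) - (γ + 1) • innerSL ℝ e).smulRight e) z := by
  have h1 : HasFDerivAt (fun z : Space d ↦ ‖z‖) (‖z‖⁻¹ • innerSL ℝ z) z := by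
    have h2 : HasFDerivAt (fun z : Space d ↦ √(‖z‖ ^ 2)) _ z :=
      (HasStrictFDerivAt.hasFDerivAt (hasStrictFDerivAt_norm_sq z)).sqrt
        (pow_ne_zero 2 (norm_ne_zero_iff.2 hz))
    simp only [Real.sqrt_sq (norm_nonneg _)] at h2
    refine h2.congr_fderiv ?_
    rw [← Nat.cast_smul_eq_nsmul ℝ, smul_smul]
    congr 1
    field_simp
    norm_num
  have h2 : HasFDerivAt (fun z : Space d ↦ ⟪e, z⟫) (innerSL ℝ e) z := (innerSL ℝ e).hasFDerivAt
  exact (hasFDerivAt_id z).add (((h1.const_mul β).sub (h2.const_mul (γ + 1))).smul_const e)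

/-- The derivative is a rank-one perturbation of the identity, so its determinant is `1 + φ e`. In
absolute value this is `‖boost γ β e z‖ / ‖z‖`: the measure `dz / ‖z‖` on the light cone is Lorentz
invariant. -/
lemma det_fderiv_boost (γ β : ℝ) {e : Space d} (he : ‖e‖ = 1) (z : Space d) :
    (ContinuousLinearMap.id ℝ (Space d) +
      (β • (‖z‖⁻¹ • innerSL ℝ z) - (γ + 1) • innerSL ℝ e).smulRight e).det =
      -(γ - β * (‖z‖⁻¹ * ⟪e, z⟫)) := by
  set φ : Space d →L[ℝ] ℝ := β • (‖z‖⁻¹ • innerSL ℝ z) - (γ + 1) • innerSL ℝ e with hφ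
  have h1 : (ContinuousLinearMap.id ℝ (Space d) + φ.smulRight e).det =
      (LinearMap.transvection (φ : Space d →ₗ[ℝ] ℝ) e).det := rfl
  rw [h1, LinearMap.transvection.det]
  simp [hφ, he, real_inner_comm e z]
  ring

lemma lintegral_boost {γ β : ℝ} (hγ : 0 < γ) (h : γ ^ 2 = 1 + β ^ 2) {e : Space d}
    (he : ‖e‖ = 1) (G : Space d → ENNReal) :
    ∫⁻ z, ENNReal.ofReal (γ - β * (‖z‖⁻¹ * ⟪e, z⟫)) * G (boost γ β e z) = ∫⁻ z, G z := by
  have hinj : InjOn (boost γ β e) {0}ᶜ := fun x _ y _ hxy ↦ by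
    rw [← boost_boost hγ h he x, hxy, boost_boost hγ h he]
  have himg : boost γ β e '' {0}ᶜ = {0}ᶜ := by
    ext z
    refine ⟨?_, fun hz ↦ ⟨_, boost_ne_zero hγ h he hz, boost_boost hγ h he z⟩⟩
    rintro ⟨w, hw, rfl⟩
    exact boost_ne_zero hγ h he hw
  have key := lintegral_image_eq_lintegral_abs_det_fderiv_mul volume
    (measurableSet_singleton (0 : Space d)).compl
    (fun z hz ↦ (hasFDerivAt_boost γ β e hz).hasFDerivWithinAt) hinj G
  rw [himg, restrict_compl_singleton] at key
  rw [key]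
  refine lintegral_congr_ae ?_
  filter_upwards [compl_mem_ae_iff.2 (measure_singleton (0 : Space d))] with z hz
  have h3 : 0 < ‖z‖ := norm_pos_iff.2 hz
  have h4 : 0 < γ - β * (‖z‖⁻¹ * ⟪e, z⟫) := by
    rw [show γ - β * (‖z‖⁻¹ * ⟪e, z⟫) = ‖z‖⁻¹ * (γ * ‖z‖ - β * ⟪e, z⟫) by field_simp]
    exact mul_pos (inv_pos.2 h3) (boost_factor_pos hγ h he hz)
  rw [det_fderiv_boost γ β he, abs_neg, abs_of_pos h4]

/-- Conformal change of variables on the sphere. -/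
lemma lintegral_sigma_boost {γ β : ℝ} (hγ : 0 < γ) (h : γ ^ 2 = 1 + β ^ 2) {e : Space d}
    (he : ‖e‖ = 1) {g : Space d → ENNReal} (hg : Measurable g) :
    ∫⁻ ω : Sph d, g ω ∂(sigma d) = ∫⁻ ω : Sph d,
      ENNReal.ofReal ((γ - β * ⟪e, (ω : Space d)⟫)⁻¹ ^ d) *
        g ((γ - β * ⟪e, (ω : Space d)⟫)⁻¹ • boost γ β e ω) ∂(sigma d) := by
  rw [lintegral_sigma, lintegral_sigma, lintegral_toSphere_transfer (measurable_boost γ β e)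
    (J := fun z ↦ ENNReal.ofReal (γ - β * (‖z‖⁻¹ * ⟪e, z⟫))) (by fun_prop)
    (fun G _ ↦ lintegral_boost hγ h he G) (fun r hr z ↦ boost_smul γ β e hr z) ?_
    (fun z hz ↦ boost_ne_zero hγ h he hz) hg]
  · congr 1
    refine lintegral_congr fun ω ↦ ?_
    have h1 : ‖(ω : Space d)‖ = 1 := norm_eq_of_mem_sphere ω
    have h0 : (ω : Space d) ≠ 0 := by rw [← norm_ne_zero_iff, h1]; exact one_ne_zero
    have h2 := boost_factor_pos hγ h he h0
    rw [h1, mul_one] at h2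
    rw [norm_boost hγ h he, h1, inv_one, one_mul, mul_one, ← ENNReal.ofReal_mul h2.le]
    congr 2
    -- The Jacobian contributes one power of the factor, turning the exponent `d + 1` of the radial
    -- projection into `d`.
    rw [pow_succ]
    field_simp
  · intro r hr z
    simp only [norm_smul, Real.norm_eq_abs, abs_of_pos hr, inner_smul_right]
    congr 3
    field_simp

/-! ### The conformal factor and the Möbius map -/

/-- The conformal factor `|y - Re|² / (1 - R²)`. -/
noncomputable def conf (R : ℝ) (e y : Space d) : ℝ := (1 + R ^ 2 - 2 * R * ⟪e, y⟫) / (1 - R ^ 2)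

lemma one_sub_sq_pos {R : ℝ} (hR : R ∈ Ioo (-1 : ℝ) 1) : 0 < 1 - R ^ 2 := by
  nlinarith [hR.1, hR.2]

lemma dist_sq_eq_conf {R : ℝ} (hR : R ∈ Ioo (-1 : ℝ) 1) {e y : Space d} (he : ‖e‖ = 1)
    (hy : ‖y‖ = 1) : dist y (R • e) ^ 2 = (1 - R ^ 2) * conf R e y := by
  rw [conf, mul_div_cancel₀ _ (one_sub_sq_pos hR).ne', dist_eq_norm, norm_sub_sq_real, norm_smul,
    inner_smul_right, he, hy, real_inner_comm, Real.norm_eq_abs, mul_one, sq_abs]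
  ring

lemma conf_eq (R : ℝ) (e y : Space d) :
    conf R e y = (1 + R ^ 2) / (1 - R ^ 2) - 2 * R / (1 - R ^ 2) * ⟪e, y⟫ := by
  rw [conf]; ring

/-- The boost parameters `γ`, `β` attached to `R`, chosen so that `conf R e y = γ - β * ⟪e, y⟫`. -/
lemma hyperbola {R : ℝ} (hR : R ∈ Ioo (-1 : ℝ) 1) :
    ((1 + R ^ 2) / (1 - R ^ 2)) ^ 2 = 1 + (2 * R / (1 - R ^ 2)) ^ 2 := by
  have := (one_sub_sq_pos hR).ne'
  field_simp
  ring

lemma hyperbola_pos {R : ℝ} (hR : R ∈ Ioo (-1 : ℝ) 1) : 0 < (1 + R ^ 2) / (1 - R ^ 2) :=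
  div_pos (by positivity) (one_sub_sq_pos hR)

lemma conf_pos {R : ℝ} (hR : R ∈ Ioo (-1 : ℝ) 1) {e y : Space d} (he : ‖e‖ = 1)
    (hy : ‖y‖ = 1) : 0 < conf R e y := by
  have h := boost_factor_pos (hyperbola_pos hR) (hyperbola hR) he
    (norm_ne_zero_iff.1 (by rw [hy]; exact one_ne_zero) : y ≠ 0)
  rwa [hy, mul_one, ← conf_eq] at h

lemma continuous_conf (R : ℝ) (e : Space d) : Continuous (conf R e) := by
  unfold conf; fun_prop

/-- The Möbius involution of the sphere exchanging the end points of the chords through `R e`,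
composed with the antipodal map in the directions orthogonal to `e`. -/
noncomputable def moebius (R : ℝ) (e y : Space d) : Space d :=
  (conf R e y)⁻¹ • boost ((1 + R ^ 2) / (1 - R ^ 2)) (2 * R / (1 - R ^ 2)) e y

lemma lintegral_sigma_moebius {R : ℝ} (hR : R ∈ Ioo (-1 : ℝ) 1) {e : Space d}
    (he : ‖e‖ = 1) {g : Space d → ENNReal} (hg : Measurable g) :
    ∫⁻ ω : Sph d, g ω ∂(sigma d) =
      ∫⁻ ω : Sph d, ENNReal.ofReal ((conf R e ω)⁻¹ ^ d) * g (moebius R e ω) ∂(sigma d) := by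
  simp only [conf_eq, moebius]
  exact lintegral_sigma_boost (hyperbola_pos hR) (hyperbola hR) he hg

lemma norm_moebius {R : ℝ} (hR : R ∈ Ioo (-1 : ℝ) 1) {e y : Space d} (he : ‖e‖ = 1)
    (hy : ‖y‖ = 1) : ‖moebius R e y‖ = 1 := by
  have h := conf_pos hR he hy
  rw [moebius, norm_smul, norm_boost (hyperbola_pos hR) (hyperbola hR) he, hy, mul_one, ← conf_eq,
    norm_inv, Real.norm_eq_abs, abs_of_pos h, inv_mul_cancel₀ h.ne']

lemma conf_moebius {R : ℝ} (hR : R ∈ Ioo (-1 : ℝ) 1) {e y : Space d} (he : ‖e‖ = 1)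
    (hy : ‖y‖ = 1) : conf R e (moebius R e y) = (conf R e y)⁻¹ := by
  have h := conf_pos hR he hy
  refine eq_inv_of_mul_eq_one_left ?_
  rw [conf_eq R e (moebius R e y), moebius, inner_smul_right,
    inner_boost _ _ he, hy]
  have h2 := hyperbola hR
  have h3 := conf_eq R e y
  generalize (1 + R ^ 2) / (1 - R ^ 2) = γ at *
  generalize 2 * R / (1 - R ^ 2) = β at *
  field_simp
  rw [h3]
  linear_combination h2

lemma dist_moebius {R : ℝ} (hR : R ∈ Ioo (-1 : ℝ) 1) {e x y : Space d} (he : ‖e‖ = 1)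
    (hx : ‖x‖ = 1) (hy : ‖y‖ = 1) :
    dist (moebius R e x) (moebius R e y) ^ 2 = (conf R e x)⁻¹ * (conf R e y)⁻¹ * dist x y ^ 2 := by
  have h1 := conf_pos hR he hx
  have h2 := conf_pos hR he hy
  rw [dist_eq_norm, dist_eq_norm, norm_sub_sq_real, norm_sub_sq_real, norm_moebius hR he hx,
    norm_moebius hR he hy, hx, hy, moebius, moebius, inner_smul_left, inner_smul_right]
  have h3 := hyperbola hR
  have h4 := conf_eq R e x
  have h5 := conf_eq R e y
  generalize (1 + R ^ 2) / (1 - R ^ 2) = γ at *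
  generalize 2 * R / (1 - R ^ 2) = β at *
  simp only [boost, inner_add_left, inner_add_right, inner_smul_right, inner_smul_left,
    real_inner_self_eq_norm_sq, he, real_inner_comm e x, hx, hy, RCLike.conj_to_real]
  field_simp
  rw [h4, h5]
  linear_combination 2 * (1 - ⟪e, x⟫ * ⟪e, y⟫) * h3

/-! ### Integrals of powers of the conformal factor -/

/-- The integral of a power of the conformal factor. -/
noncomputable def confInt (d : ℕ) (R : ℝ) (e : Space d) (κ : ℝ) : ℝ :=
  ∫ y : Sph d, conf R e y ^ (-κ) ∂(sigma d)

lemma continuous_conf_rpow {R : ℝ} (hR : R ∈ Ioo (-1 : ℝ) 1) {e : Space d} (he : ‖e‖ = 1)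
    (κ : ℝ) : Continuous fun y : Sph d ↦ conf R e y ^ κ :=
  ((continuous_conf R e).comp continuous_subtype_val).rpow_const
    fun y ↦ Or.inl (conf_pos hR he (norm_eq_of_mem_sphere y)).ne'

lemma integrable_of_continuous {μ : Measure (Sph d)} [IsFiniteMeasure μ] {g : Sph d → ℝ}
    (hg : Continuous g) : Integrable g μ :=
  hg.integrable_of_hasCompactSupport (HasCompactSupport.of_compactSpace g)

/-- The Möbius substitution inverts the conformal factor and has Jacobian `conf ^ (-d)`, so it sends
the exponent `-κ` to `κ - d`. -/
lemma confInt_symm {R : ℝ} (hR : R ∈ Ioo (-1 : ℝ) 1) {e : Space d} (he : ‖e‖ = 1) (κ : ℝ) :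
    confInt d R e κ = confInt d R e (d - κ) := by
  have hpos : ∀ y : Sph d, 0 < conf R e y := fun y ↦ conf_pos hR he (norm_eq_of_mem_sphere y)
  rw [confInt, confInt, integral_eq_lintegral_of_nonneg_ae
      (Filter.Eventually.of_forall fun y ↦ (Real.rpow_pos_of_pos (hpos y) _).le)
      (continuous_conf_rpow hR he _).aestronglyMeasurable,
    integral_eq_lintegral_of_nonneg_ae
      (Filter.Eventually.of_forall fun y ↦ (Real.rpow_pos_of_pos (hpos y) _).le)
      (continuous_conf_rpow hR he _).aestronglyMeasurable]
  congr 1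
  rw [lintegral_sigma_moebius hR he (g := fun y ↦ ENNReal.ofReal (conf R e y ^ (-κ)))
    ((continuous_conf R e).measurable.pow_const _).ennreal_ofReal]
  refine lintegral_congr fun y ↦ ?_
  rw [conf_moebius hR he (norm_eq_of_mem_sphere y), ← ENNReal.ofReal_mul (by have := hpos y; positivity)]
  congr 1
  rw [Real.inv_rpow (hpos y).le, ← Real.rpow_neg (hpos y).le, ← Real.rpow_natCast,
    Real.inv_rpow (hpos y).le, ← Real.rpow_neg (hpos y).le, ← Real.rpow_add (hpos y)]
  ring_nf

/-- By the hypothesis on `κ`, it lies between `d - (κ + 1)` and `κ + 1`, two exponents with the same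
integral by symmetry. Convexity in the exponent then bounds the value in between. -/
lemma confInt_le_succ {R : ℝ} (hR : R ∈ Ioo (-1 : ℝ) 1) {e : Space d} (he : ‖e‖ = 1) {κ : ℝ}
    (hκ : (d : ℝ) - 1 ≤ 2 * κ) : confInt d R e κ ≤ confInt d R e (κ + 1) := by
  have hpos : ∀ y : Sph d, 0 < conf R e y := fun y ↦ conf_pos hR he (norm_eq_of_mem_sphere y)
  obtain ⟨θ, hθ, hθ1, hθκ⟩ : ∃ θ : ℝ, 0 ≤ θ ∧ θ ≤ 1 ∧ κ = θ * (κ + 1) + (1 - θ) * (d - (κ + 1)) := by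
    have : 0 < 2 * κ + 2 - d := by linarith
    refine ⟨(2 * κ + 1 - d) / (2 * κ + 2 - d), div_nonneg (by linarith) this.le, ?_, ?_⟩
    · rw [div_le_one this]; linarith
    · linear_combination -(div_mul_cancel₀ (2 * κ + 1 - d) this.ne')
  have h1 : confInt d R e κ ≤ θ * confInt d R e (κ + 1) + (1 - θ) * confInt d R e (d - (κ + 1)) := by
    simp only [confInt]
    rw [← integral_const_mul, ← integral_const_mul, ← integral_add]
    · refine integral_mono (integrable_of_continuous (continuous_conf_rpow hR he _))
        (integrable_of_continuous ?_) fun y ↦ ?_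
      · exact ((continuous_conf_rpow hR he _).const_mul _).add
          ((continuous_conf_rpow hR he _).const_mul _)
      · have := Real.geom_mean_le_arith_mean2_weighted hθ (sub_nonneg.2 hθ1)
          (Real.rpow_pos_of_pos (hpos y) (-(κ + 1))).le
          (Real.rpow_pos_of_pos (hpos y) (-(d - (κ + 1)))).le (by ring)
        refine le_trans (le_of_eq ?_) this
        rw [← Real.rpow_mul (hpos y).le, ← Real.rpow_mul (hpos y).le, ← Real.rpow_add (hpos y)]
        congr 1
        linarith
    · exact integrable_of_continuous ((continuous_conf_rpow hR he _).const_mul _)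
    · exact integrable_of_continuous ((continuous_conf_rpow hR he _).const_mul _)
  rw [← confInt_symm hR he] at h1
  linarith

/-! ### Cap estimates and the potential of the surface measure -/

/-- Caps of radius `δ` have `σ_d`-measure `O(δ^d)`. -/
lemma sigma_closedBall_le (x : Sph d) {δ : ℝ} (hδ : 0 < δ) :
    sigma d (Metric.closedBall x δ) ≤ ENNReal.ofReal ((4 * δ) ^ d) := by
  rcases le_or_gt 1 δ with h1 | h1
  · refine prob_le_one.trans ?_
    rw [← ENNReal.ofReal_one]
    exact ENNReal.ofReal_le_ofReal (one_le_pow₀ (by linarith))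
  have hR : 1 - δ ∈ Ioo (-1 : ℝ) 1 := ⟨by linarith, by linarith⟩
  have hx := norm_eq_of_mem_sphere x
  have hpos : ∀ y : Sph d, 0 < conf (1 - δ) (x : Space d) y :=
    fun y ↦ conf_pos hR hx (norm_eq_of_mem_sphere y)
  -- The Möbius Jacobian at `R = 1 - δ` is a probability density concentrating near `x`. On the cap
  -- it is at least `(4 * δ)⁻¹ ^ d`, because there `dist² ≤ 4δ²` while `1 - R² ≥ δ`.
  have hint : ∫⁻ y : Sph d, ENNReal.ofReal ((conf (1 - δ) (x : Space d) y)⁻¹ ^ d) ∂(sigma d) = 1 := by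
    have := lintegral_sigma_moebius hR hx (g := fun _ ↦ 1) measurable_const
    simpa using this.symm
  have hle : ∀ y ∈ Metric.closedBall x δ, ENNReal.ofReal ((4 * δ)⁻¹ ^ d) ≤
      ENNReal.ofReal ((conf (1 - δ) (x : Space d) y)⁻¹ ^ d) := by
    intro y hy
    refine ENNReal.ofReal_le_ofReal ?_
    have hp := hpos y
    gcongr
    have h2 := dist_sq_eq_conf hR hx (norm_eq_of_mem_sphere y)
    have h3 : dist (y : Space d) ((1 - δ) • (x : Space d)) ≤ 2 * δ := by
      have h4 : dist (x : Space d) ((1 - δ) • (x : Space d)) = δ := by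
        rw [dist_eq_norm, sub_smul, one_smul, sub_sub_cancel, norm_smul, hx, mul_one,
          Real.norm_eq_abs, abs_of_pos hδ]
      have h5 : dist (y : Space d) x ≤ δ := hy
      linarith [dist_triangle (y : Space d) x ((1 - δ) • (x : Space d))]
    have h6 : dist (y : Space d) ((1 - δ) • (x : Space d)) ^ 2 ≤ (2 * δ) ^ 2 := by gcongr
    have h7 : δ * conf (1 - δ) (x : Space d) y ≤ (1 - (1 - δ) ^ 2) * conf (1 - δ) (x : Space d) y :=
      mul_le_mul_of_nonneg_right (by nlinarith) hp.le
    exact le_of_mul_le_mul_left (by linarith) hδ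
  have h2 : ENNReal.ofReal ((4 * δ)⁻¹ ^ d) * sigma d (Metric.closedBall x δ) ≤ 1 := by
    rw [← hint, ← setLIntegral_const]
    exact (setLIntegral_mono' Metric.isClosed_closedBall.measurableSet hle).trans
      (setLIntegral_le_lintegral _ _)
  have hp : 0 < (4 * δ) ^ d := by positivity
  rw [inv_pow, ENNReal.ofReal_inv_of_pos hp, mul_comm, ← div_eq_mul_inv] at h2
  rwa [ENNReal.div_le_iff (by simpa using hp) ENNReal.ofReal_ne_top, one_mul] at h2

lemma sigma_singleton (hd : 1 ≤ d) (x : Sph d) : sigma d {x} = 0 := by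
  have h : Filter.Tendsto (fun δ : ℝ ↦ ENNReal.ofReal ((4 * δ) ^ d)) (nhdsWithin 0 (Ioi 0))
      (nhds 0) := by
    have h1 : Continuous fun δ : ℝ ↦ ENNReal.ofReal ((4 * δ) ^ d) :=
      ENNReal.continuous_ofReal.comp (by fun_prop)
    have h2 := h1.tendsto 0
    rw [mul_zero, zero_pow (by omega), ENNReal.ofReal_zero] at h2
    exact h2.mono_left nhdsWithin_le_nhds
  refine le_antisymm (ge_of_tendsto h ?_) zero_le
  filter_upwards [self_mem_nhdsWithin] with δ hδ
  exact (measure_mono (by simpa using le_of_lt hδ)).trans (sigma_closedBall_le x hδ)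

lemma edist_rpow_neg {E : Type*} [MetricSpace E] {x y : E} (h : x ≠ y) (s : ℝ) :
    edist x y ^ (-s) = ENNReal.ofReal (dist x y ^ (-s)) := by
  rw [edist_dist, ENNReal.ofReal_rpow_of_pos (dist_pos.2 h)]

lemma ae_ne_sigma (hd : 1 ≤ d) (x : Sph d) : ∀ᵐ y : Sph d ∂(sigma d), (x : Space d) ≠ y := by
  filter_upwards [compl_mem_ae_iff.2 (sigma_singleton hd x)] with y hy
  exact fun h ↦ hy (Subtype.ext h.symm)

lemma rieszPotential_sigma_eq (hd : 1 ≤ d) (s : ℝ) (x : Sph d) :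
    rieszPotential s (sigma d) (x : Space d) =
      ∫⁻ y : Sph d, ENNReal.ofReal (dist (x : Space d) y ^ (-s)) ∂(sigma d) := by
  refine lintegral_congr_ae ?_
  filter_upwards [ae_ne_sigma hd x] with y hy
  exact edist_rpow_neg hy s

/-- Layer-cake formula: the superlevel set at height `t` is a cap of radius `t⁻¹`, so the tail is
dominated by a multiple of `t ^ (s - 1 - d)`, integrable at infinity since `s < d`. -/
lemma rieszPotential_sigma_lt_top (hd : 1 ≤ d) {s : ℝ} (hs0 : 0 < s) (hs : s < d) (x : Sph d) :
    rieszPotential s (sigma d) (x : Space d) < ⊤ := by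
  rw [rieszPotential_sigma_eq hd]
  have h1 : ∀ y : Sph d, dist (x : Space d) y ^ (-s) = (dist (x : Space d) y)⁻¹ ^ s := fun y ↦ by
    rw [Real.rpow_neg dist_nonneg, Real.inv_rpow dist_nonneg]
  simp only [h1]
  rw [lintegral_rpow_eq_lintegral_meas_le_mul _
    (Filter.Eventually.of_forall fun y ↦ inv_nonneg.2 dist_nonneg) (by fun_prop) hs0]
  refine ENNReal.mul_lt_top ENNReal.ofReal_lt_top ?_
  rw [← Ioc_union_Ioi_eq_Ioi zero_le_one]
  refine (lintegral_union_le _ _ _).trans_lt (ENNReal.add_lt_top.2 ⟨?_, ?_⟩)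
  · have h2 : IntegrableOn (fun t : ℝ ↦ t ^ (s - 1)) (Ioc 0 1) :=
      (intervalIntegral.intervalIntegrable_rpow' (by linarith)).1
    refine lt_of_le_of_lt (lintegral_mono fun t ↦ ?_) h2.lintegral_lt_top
    exact mul_le_of_le_one_left' prob_le_one
  · have h2 : IntegrableOn (fun t : ℝ ↦ (4 : ℝ) ^ d * t ^ (s - 1 - d)) (Ioi 1) :=
      (integrableOn_Ioi_rpow_of_lt (by linarith) one_pos).const_mul _
    refine lt_of_le_of_lt (setLIntegral_mono' measurableSet_Ioi fun t ht ↦ ?_) h2.lintegral_lt_top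
    have ht0 : (0 : ℝ) < t := one_pos.trans ht
    have h3 : {y : Sph d | t ≤ (dist (x : Space d) y)⁻¹} ⊆ Metric.closedBall x t⁻¹ := by
      intro y hy
      rw [Metric.mem_closedBall, dist_comm]
      have hy' : t ≤ (dist (x : Space d) y)⁻¹ := hy
      have hd0 : 0 < dist (x : Space d) y := inv_pos.1 (ht0.trans_le hy')
      exact (le_inv_comm₀ ht0 hd0).1 hy'
    refine (mul_le_mul_left ((measure_mono h3).trans
      (sigma_closedBall_le x (inv_pos.2 ht0))) _).trans ?_
    rw [← ENNReal.ofReal_mul (by positivity)]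
    refine le_of_eq (congrArg _ ?_)
    rw [Real.rpow_sub ht0 (s - 1) d, Real.rpow_natCast, mul_pow, inv_pow]
    ring

lemma exists_isometry_eq {x y : Space d} (h : ‖x‖ = ‖y‖) : ∃ L : Space d ≃ₗᵢ[ℝ] Space d, L x = y :=
  ⟨_, Submodule.reflection_sub h⟩

lemma measurable_kernel (s : ℝ) (x : Space d) : Measurable fun y : Space d ↦ edist x y ^ (-s) :=
  (measurable_edist_right).pow_const _

lemma rieszPotential_sigma_isometry (s : ℝ) (L : Space d ≃ₗᵢ[ℝ] Space d) (x : Space d) :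
    rieszPotential s (sigma d) (L x) = rieszPotential s (sigma d) x := by
  simp only [rieszPotential]
  rw [← lintegral_sigma_isometry L (measurable_kernel s (L x))]
  simp only [L.edist_map]

lemma norm_axis : ‖axis d‖ = 1 := by simp [axis]

lemma rieszPotential_sigma_const (s : ℝ) {x : Space d} (hx : ‖x‖ = 1) :
    rieszPotential s (sigma d) x = rieszPotential s (sigma d) (axis d) := by
  obtain ⟨L, hL⟩ := exists_isometry_eq (norm_axis.trans hx.symm)
  rw [← hL, rieszPotential_sigma_isometry]

/-- The potential of the balayage of a point mass inside the sphere. -/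
lemma lintegral_kernel_conf {s R : ℝ} (hR : R ∈ Ioo (-1 : ℝ) 1) {e x : Space d} (he : ‖e‖ = 1)
    (hx : ‖x‖ = 1) :
    ∫⁻ y : Sph d, edist x y ^ (-s) * ENNReal.ofReal (conf R e y ^ (s / 2 - d)) ∂(sigma d) =
      rieszPotential s (sigma d) (axis d) * ENNReal.ofReal (conf R e x ^ (-(s / 2))) := by
  -- The constant potential of `sigma d` is evaluated at the Möbius image of `x` and pulled back.
  -- Distances scale by `(conf x * conf y) ^ (-1/2)`, which splits the kernel into the power of
  -- `conf` at `x` and the density at `y`.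
  rw [← rieszPotential_sigma_const s (norm_moebius hR he hx), rieszPotential,
    lintegral_sigma_moebius hR he (measurable_kernel s (moebius R e x)), ← lintegral_mul_const]
  swap
  · have : Measurable fun y : Space d ↦ ENNReal.ofReal ((conf R e y)⁻¹ ^ d) *
        edist (moebius R e x) (moebius R e y) ^ (-s) := by
      have h1 := (continuous_conf R e).measurable
      have h2 : Measurable (moebius R e) := h1.inv.smul (measurable_boost _ _ e)
      exact (h1.inv.pow_const d).ennreal_ofReal.mul
        (((measurable_const).edist h2).pow_const _)
    exact this.comp measurable_subtype_coe
  refine lintegral_congr fun y ↦ ?_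
  have hy := norm_eq_of_mem_sphere y
  have hcx := conf_pos hR he hx
  have hcy := conf_pos hR he hy
  have h1 : dist (moebius R e x) (moebius R e y) =
      dist x y * (conf R e x * conf R e y) ^ (-(1 / 2) : ℝ) := by
    refine (sq_eq_sq₀ dist_nonneg (by positivity)).1 ?_
    rw [dist_moebius hR he hx hy, mul_pow, ← Real.rpow_natCast (_ ^ (-(1 / 2) : ℝ)) 2,
      ← Real.rpow_mul (by positivity)]
    norm_num
    rw [Real.rpow_neg_one, mul_inv]
    ring
  rw [edist_dist (moebius R e x), h1, ENNReal.ofReal_mul dist_nonneg, ← edist_dist,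
    ENNReal.mul_rpow_of_ne_top (edist_ne_top _ _) ENNReal.ofReal_ne_top,
    ENNReal.ofReal_rpow_of_pos (by positivity), ← mul_assoc, mul_comm (ENNReal.ofReal _) (edist x _ ^ _),
    mul_assoc, mul_assoc, ← ENNReal.ofReal_mul (by positivity), ← ENNReal.ofReal_mul (by positivity)]
  congr 2
  rw [← Real.rpow_mul (by positivity), Real.mul_rpow hcx.le hcy.le,
    show (-(1 / 2) : ℝ) * -s = s / 2 by ring, Real.rpow_neg hcx.le, Real.rpow_sub hcy,
    Real.rpow_natCast, inv_pow]
  have hX := (Real.rpow_pos_of_pos hcx (s / 2)).ne'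
  field_simp

/-! ### The potential `U` on the polar axis -/

lemma hasDerivAt_integral_of_compact {μ : Measure (Sph d)} [IsFiniteMeasure μ]
    {F F' : ℝ → Sph d → ℝ} {I : Set ℝ} (hI : IsOpen I) {x₀ : ℝ} (hx₀ : x₀ ∈ I)
    (hF : ∀ x ∈ I, Continuous (F x))
    (hF' : ContinuousOn (Function.uncurry F') (I ×ˢ univ))
    (hderiv : ∀ x ∈ I, ∀ y, HasDerivAt (fun x ↦ F x y) (F' x y) x) :
    HasDerivAt (fun x ↦ ∫ y, F x y ∂μ) (∫ y, F' x₀ y ∂μ) x₀ := by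
  obtain ⟨ε, hε, hsub⟩ := Metric.nhds_basis_closedBall.mem_iff.1 (hI.mem_nhds hx₀)
  obtain ⟨C, hC⟩ := ((isCompact_closedBall x₀ ε).prod isCompact_univ).exists_bound_of_continuousOn
    (hF'.mono (prod_mono hsub subset_rfl))
  have hF'x : Continuous (F' x₀) :=
    hF'.comp_continuous (f := fun y ↦ (x₀, y)) (by fun_prop) fun y ↦ ⟨hx₀, mem_univ _⟩
  refine (hasDerivAt_integral_of_dominated_loc_of_deriv_le (bound := fun _ ↦ C)
    (Metric.ball_mem_nhds x₀ hε) ?_ (integrable_of_continuous (hF _ hx₀))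
    hF'x.aestronglyMeasurable ?_ (integrable_const C) ?_).2
  · filter_upwards [hI.mem_nhds hx₀] with x hx
    exact (hF x hx).aestronglyMeasurable
  · exact Filter.Eventually.of_forall fun y x hx ↦ hC (x, y) ⟨Metric.ball_subset_closedBall hx, mem_univ _⟩
  · exact Filter.Eventually.of_forall fun y x hx ↦
      hderiv x (hsub (Metric.ball_subset_closedBall hx)) y

lemma norm_sub_smul_sq {e y : Space d} (he : ‖e‖ = 1) (hy : ‖y‖ = 1) (R : ℝ) :
    dist (R • e) y ^ 2 = 1 + R ^ 2 - 2 * R * ⟪e, y⟫ := by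
  rw [dist_eq_norm, norm_sub_sq_real, norm_smul, inner_smul_left, he, hy, Real.norm_eq_abs,
    mul_one, sq_abs, RCLike.conj_to_real]
  ring

lemma quad_pos {R : ℝ} (hR : R ∈ Ioo (-1 : ℝ) 1) {e y : Space d} (he : ‖e‖ = 1) (hy : ‖y‖ = 1) :
    0 < 1 + R ^ 2 - 2 * R * ⟪e, y⟫ := by
  have h := mul_pos (one_sub_sq_pos hR) (conf_pos hR he hy)
  rwa [conf, mul_div_cancel₀ _ (one_sub_sq_pos hR).ne'] at h

lemma smul_ne_of_mem_ball {R : ℝ} (hR : R ∈ Ioo (-1 : ℝ) 1) {e y : Space d} (he : ‖e‖ = 1)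
    (hy : ‖y‖ = 1) : R • e ≠ y := by
  rintro rfl
  rw [norm_smul, he, mul_one, Real.norm_eq_abs] at hy
  exact (abs_lt.2 hR).ne hy

lemma dist_rpow_eq {e y : Space d} (he : ‖e‖ = 1) (hy : ‖y‖ = 1) (R s : ℝ) :
    dist (R • e) y ^ (-s) = (1 + R ^ 2 - 2 * R * ⟪e, y⟫) ^ (-(s / 2)) := by
  rw [← norm_sub_smul_sq he hy, ← Real.rpow_natCast, ← Real.rpow_mul dist_nonneg]
  congr 1
  push_cast
  ring

/-- The north pole as a point of the sphere. -/
noncomputable def northPole (d : ℕ) : Sph d := ⟨axis d, by simp [axis]⟩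

lemma Icc_zero_one_cases {R : ℝ} (hR : R ∈ Icc (0 : ℝ) 1) : R ∈ Ioo (-1 : ℝ) 1 ∨ R = 1 := by
  rcases hR.2.lt_or_eq with h | h
  · exact Or.inl ⟨by linarith [hR.1], h⟩
  · exact Or.inr h

lemma ae_smul_axis_ne (hd : 1 ≤ d) {R : ℝ} (hR : R ∈ Icc (0 : ℝ) 1) :
    ∀ᵐ y : Sph d ∂(sigma d), R • axis d ≠ (y : Space d) := by
  rcases Icc_zero_one_cases hR with h | rfl
  · exact Filter.Eventually.of_forall fun y ↦
      smul_ne_of_mem_ball h norm_axis (norm_eq_of_mem_sphere y)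
  · rw [one_smul]; exact ae_ne_sigma hd (northPole d)

lemma measurable_dist_rpow (s : ℝ) (a : Space d) : Measurable fun y : Sph d ↦ dist a y ^ (-s) :=
  (measurable_const.dist measurable_subtype_coe).pow_const _

lemma U_eq_integral (hd : 1 ≤ d) {s R : ℝ} (hR : R ∈ Icc (0 : ℝ) 1) :
    U d s R = ∫ y : Sph d, dist (R • axis d) y ^ (-s) ∂(sigma d) := by
  rw [integral_eq_lintegral_of_nonneg_ae (Filter.Eventually.of_forall fun y ↦ by positivity)
    (measurable_dist_rpow _ _).aestronglyMeasurable, U, rieszPotential]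
  congr 1
  refine lintegral_congr_ae ?_
  filter_upwards [ae_smul_axis_ne hd hR] with y hy
  exact edist_rpow_neg hy s

lemma integrable_kernel_sigma (hd : 1 ≤ d) {s : ℝ} (hs0 : 0 < s) (hs : s < d) (x : Sph d) :
    Integrable (fun y : Sph d ↦ dist (x : Space d) y ^ (-s)) (sigma d) := by
  refine ⟨(measurable_dist_rpow _ _).aestronglyMeasurable, ?_⟩
  rw [hasFiniteIntegral_iff_ofReal (Filter.Eventually.of_forall fun y ↦ by positivity),
    ← rieszPotential_sigma_eq hd]
  exact rieszPotential_sigma_lt_top hd hs0 hs x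

/-- Since `1 - R` is the distance from `R • axis d` to the sphere, the triangle inequality through
that point suffices. This yields one integrable majorant for all `R` up to `1`, where the kernel
becomes singular. -/
lemma dist_axis_le {R : ℝ} (hR : R ∈ Icc (0 : ℝ) 1) {y : Space d} (hy : ‖y‖ = 1) :
    dist (axis d) y ≤ 2 * dist (R • axis d) y := by
  have h1 : dist (axis d) (R • axis d) = 1 - R := by
    have : axis d - R • axis d = (1 - R) • axis d := by rw [sub_smul, one_smul]
    rw [dist_eq_norm, this, norm_smul, norm_axis, mul_one, Real.norm_eq_abs,
      abs_of_nonneg (by linarith [hR.2])]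
  have h2 : 1 - R ≤ dist (R • axis d) y := by
    have := norm_sub_norm_le y (R • axis d)
    rwa [hy, norm_smul, norm_axis, mul_one, Real.norm_eq_abs, abs_of_nonneg hR.1,
      ← dist_eq_norm, dist_comm] at this
  linarith [dist_triangle (axis d) (R • axis d) y]

lemma continuousOn_U (hd : 1 ≤ d) {s : ℝ} (hs0 : 0 < s) (hs : s < d) :
    ContinuousOn (U d s) (Icc 0 1) := by
  have h : ContinuousOn (fun R : ℝ ↦ ∫ y : Sph d, dist (R • axis d) y ^ (-s) ∂(sigma d)) (Icc 0 1) := by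
    refine continuousOn_of_dominated (F := fun (R : ℝ) (y : Sph d) ↦ dist (R • axis d) y ^ (-s))
      (bound := fun y ↦ 2 ^ s * dist (axis d) y ^ (-s))
      (fun R _ ↦ (measurable_dist_rpow _ _).aestronglyMeasurable) (fun R hR ↦ ?_)
      ((integrable_kernel_sigma hd hs0 hs (northPole d)).const_mul _) ?_
    · filter_upwards [ae_ne_sigma hd (northPole d)] with y hy
      have h1 : 0 < dist (axis d) y := dist_pos.2 hy
      have h2 := dist_axis_le hR (norm_eq_of_mem_sphere y)
      have h3 : 0 < dist (R • axis d) y := by linarith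
      rw [Real.norm_eq_abs, abs_of_nonneg (by positivity), Real.rpow_neg h3.le, Real.rpow_neg h1.le,
        ← div_eq_mul_inv, ← inv_div, ← Real.div_rpow h1.le (by norm_num)]
      gcongr
      linarith
    · filter_upwards [ae_ne_sigma hd (northPole d)] with y hy
      intro R hR
      have h1 : 0 < dist (axis d) y := dist_pos.2 hy
      have h2 := dist_axis_le hR (norm_eq_of_mem_sphere y)
      refine ContinuousAt.continuousWithinAt ?_
      exact ContinuousAt.rpow_const (by fun_prop) (Or.inl (by linarith))
  exact h.congr fun R hR ↦ U_eq_integral hd hR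

lemma U_zero (hd : 1 ≤ d) (s : ℝ) : U d s 0 = 1 := by
  rw [U_eq_integral hd (by simp)]
  simp

lemma U_eq_integral_quad (hd : 1 ≤ d) {s R : ℝ} (hR : R ∈ Icc (0 : ℝ) 1) :
    U d s R = ∫ y : Sph d, (1 + R ^ 2 - 2 * R * ⟪axis d, (y : Space d)⟫) ^ (-(s / 2)) ∂(sigma d) := by
  rw [U_eq_integral hd hR]
  exact integral_congr_ae (Filter.Eventually.of_forall fun y ↦
    dist_rpow_eq norm_axis (norm_eq_of_mem_sphere y) R s)

lemma quad_rpow {R : ℝ} (hR : R ∈ Ioo (-1 : ℝ) 1) {e y : Space d} (he : ‖e‖ = 1) (hy : ‖y‖ = 1)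
    (κ : ℝ) : (1 + R ^ 2 - 2 * R * ⟪e, y⟫) ^ κ = (1 - R ^ 2) ^ κ * conf R e y ^ κ := by
  rw [← Real.mul_rpow (one_sub_sq_pos hR).le (conf_pos hR he hy).le, conf,
    mul_div_cancel₀ _ (one_sub_sq_pos hR).ne']

lemma U_eq_confInt (hd : 1 ≤ d) {s R : ℝ} (hR : R ∈ Ico (0 : ℝ) 1) :
    U d s R = (1 - R ^ 2) ^ (-(s / 2)) * confInt d R (axis d) (s / 2) := by
  have hR' : R ∈ Ioo (-1 : ℝ) 1 := ⟨by linarith [hR.1], hR.2⟩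
  rw [U_eq_integral_quad hd ⟨hR.1, hR.2.le⟩, confInt, ← integral_const_mul]
  exact integral_congr_ae (Filter.Eventually.of_forall fun y ↦
    quad_rpow hR' norm_axis (norm_eq_of_mem_sphere y) _)

lemma hasDerivAt_quad_rpow {R : ℝ} (hR : R ∈ Ioo (-1 : ℝ) 1) {e y : Space d} (he : ‖e‖ = 1)
    (hy : ‖y‖ = 1) (κ : ℝ) :
    HasDerivAt (fun R ↦ (1 + R ^ 2 - 2 * R * ⟪e, y⟫) ^ κ)
      ((2 * R - 2 * ⟪e, y⟫) * κ * (1 + R ^ 2 - 2 * R * ⟪e, y⟫) ^ (κ - 1)) R := by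
  have h : HasDerivAt (fun R : ℝ ↦ 1 + R ^ 2 - 2 * R * ⟪e, y⟫) (2 * R - 2 * ⟪e, y⟫) R := by
    have h1 : HasDerivAt (fun R : ℝ ↦ 1 + R ^ 2 - 2 * R * ⟪e, y⟫) _ R :=
      ((hasDerivAt_pow 2 R).const_add 1).sub (((hasDerivAt_id' R).const_mul 2).mul_const ⟪e, y⟫)
    exact h1.congr_deriv (by simp)
  exact h.rpow_const (Or.inl (quad_pos hR he hy).ne')

/-- With `t = ⟪axis d, y⟫`, one has `2R(R - t) = (1 - R²)(conf - 1)`. So differentiating under the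
integral gives a difference of two conformal integrals whose exponents differ by one. -/
lemma hasDerivAt_U (hd : 1 ≤ d) {s R : ℝ} (hR : R ∈ Ioo (0 : ℝ) 1) :
    HasDerivAt (U d s) (s / 2 / R * (1 - R ^ 2) ^ (-(s / 2)) *
      (confInt d R (axis d) (s / 2 + 1) - confInt d R (axis d) (s / 2))) R := by
  have hR' : R ∈ Ioo (-1 : ℝ) 1 := ⟨by linarith [hR.1], hR.2⟩
  have hsub : Ioo (0 : ℝ) 1 ⊆ Ioo (-1) 1 := Ioo_subset_Ioo_left (by norm_num)
  have h := hasDerivAt_integral_of_compact (μ := sigma d) (x₀ := R) (I := Ioo 0 1)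
    (F := fun R y ↦ (1 + R ^ 2 - 2 * R * ⟪axis d, (y : Space d)⟫) ^ (-(s / 2)))
    (F' := fun R y ↦ (2 * R - 2 * ⟪axis d, (y : Space d)⟫) * (-(s / 2)) *
      (1 + R ^ 2 - 2 * R * ⟪axis d, (y : Space d)⟫) ^ (-(s / 2) - 1)) isOpen_Ioo hR ?_ ?_ ?_
  · refine (h.congr_of_eventuallyEq ?_).congr_deriv ?_
    · filter_upwards [isOpen_Ioo.mem_nhds hR] with x hx
      exact U_eq_integral_quad hd ⟨hx.1.le, hx.2.le⟩
    · rw [confInt, confInt, ← integral_sub (integrable_of_continuous (continuous_conf_rpow hR' norm_axis _))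
        (integrable_of_continuous (continuous_conf_rpow hR' norm_axis _)), ← integral_const_mul]
      refine integral_congr_ae (Filter.Eventually.of_forall fun y ↦ ?_)
      have hy := norm_eq_of_mem_sphere y
      have hc := one_sub_sq_pos hR'
      have hm := conf_pos hR' norm_axis hy
      have hm2 : (1 - R ^ 2) * conf R (axis d) y = 1 + R ^ 2 - 2 * R * ⟪axis d, (y : Space d)⟫ := by
        rw [conf, mul_div_cancel₀ _ hc.ne']
      have hR0 := hR.1.ne'
      simp only [neg_add, ← sub_eq_add_neg]
      rw [quad_rpow hR' norm_axis hy, Real.rpow_sub_one hc.ne', Real.rpow_sub_one hm.ne']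
      field_simp
      linear_combination s * hm2
  · intro x hx
    exact Continuous.rpow_const (by fun_prop)
      fun y ↦ Or.inl (quad_pos (hsub hx) norm_axis (norm_eq_of_mem_sphere y)).ne'
  · refine ContinuousOn.mul (by fun_prop) (ContinuousOn.rpow_const (by fun_prop) ?_)
    rintro ⟨x, y⟩ ⟨hx, -⟩
    exact Or.inl (quad_pos (hsub hx) norm_axis (norm_eq_of_mem_sphere y)).ne'
  · intro x hx y
    exact hasDerivAt_quad_rpow (hsub hx) norm_axis (norm_eq_of_mem_sphere y) _

/-- The lower bound `d - 1 < s` enters here, through `confInt_le_succ` with `κ = s / 2`. -/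
lemma monotoneOn_U (hd : 1 ≤ d) {s : ℝ} (hs0 : 0 < s) (hs1 : (d : ℝ) - 1 < s) (hs : s < d) :
    MonotoneOn (U d s) (Icc 0 1) := by
  refine monotoneOn_of_deriv_nonneg (convex_Icc 0 1) (continuousOn_U hd hs0 hs) ?_ ?_ <;>
    rw [interior_Icc]
  · exact fun R hR ↦ (hasDerivAt_U hd hR).differentiableAt.differentiableWithinAt
  · intro R hR
    have hR' : R ∈ Ioo (-1 : ℝ) 1 := ⟨by linarith [hR.1], hR.2⟩
    rw [(hasDerivAt_U hd hR).deriv]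
    have h1 : 0 < 1 - R ^ 2 := one_sub_sq_pos hR'
    have h2 := hR.1
    refine mul_nonneg (by positivity) (sub_nonneg.2 (confInt_le_succ hR' norm_axis (by linarith)))

/-- Convexity of `x ^ (-κ)`: for a fixed sum, the pair spread furthest apart has the largest total.
The convexity itself comes from the weighted AM-GM inequality, applied to `A, B` and to their
powers. -/
lemma rpow_neg_le_of_add_eq {A B a b κ : ℝ} (hA : 0 < A) (hAB : A < B) (hκ : 0 ≤ κ) (ha : A ≤ a)
    (hb : A ≤ b) (hab : a + b = A + B) : a ^ (-κ) + b ^ (-κ) ≤ A ^ (-κ) + B ^ (-κ) := by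
  have hB := hA.trans hAB
  have key : ∀ θ : ℝ, 0 ≤ θ → θ ≤ 1 → (θ * A + (1 - θ) * B) ^ (-κ) ≤
      θ * A ^ (-κ) + (1 - θ) * B ^ (-κ) := by
    intro θ h0 h1
    have h1' := sub_nonneg.2 h1
    have h2 := Real.geom_mean_le_arith_mean2_weighted h0 h1' hA.le hB.le (by ring)
    have h3 := Real.geom_mean_le_arith_mean2_weighted h0 h1'
      (Real.rpow_pos_of_pos hA (-κ)).le (Real.rpow_pos_of_pos hB (-κ)).le (by ring)
    refine le_trans ?_ h3
    rw [← Real.rpow_mul hA.le, ← Real.rpow_mul hB.le, mul_comm (-κ), mul_comm (-κ),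
      Real.rpow_mul hA.le, Real.rpow_mul hB.le, ← Real.mul_rpow (by positivity) (by positivity)]
    exact Real.rpow_le_rpow_of_nonpos (by positivity) h2 (by linarith)
  have hBA := sub_pos.2 hAB
  have e1 : a = (b - A) / (B - A) * A + (1 - (b - A) / (B - A)) * B := by
    field_simp; linear_combination (B - A) * hab
  have e2 : b = (1 - (b - A) / (B - A)) * A + (1 - (1 - (b - A) / (B - A))) * B := by
    field_simp; ring
  have h0 : 0 ≤ (b - A) / (B - A) := div_nonneg (by linarith) hBA.le
  have h1 : (b - A) / (B - A) ≤ 1 := by rw [div_le_one hBA]; linarith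
  have k1 := key _ h0 h1
  have k2 := key _ (sub_nonneg.2 h1) (by linarith)
  rw [← e1] at k1
  rw [← e2] at k2
  linarith

/-- Average the kernel over antipodal pairs. The squared distances to `y` and `-y` always sum to `(1
- R)² + (1 + R)²`, so convexity makes the pair of poles extremal. -/
lemma U_le (hd : 1 ≤ d) {s R : ℝ} (hs0 : 0 < s) (hR : R ∈ Ioo (0 : ℝ) 1) :
    U d s R ≤ ((1 - R) ^ (-s) + (1 + R) ^ (-s)) / 2 := by
  have hR' : R ∈ Ioo (-1 : ℝ) 1 := ⟨by linarith [hR.1], hR.2⟩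
  have hcont : ∀ e : Space d, ‖e‖ = 1 → Continuous fun y : Sph d ↦
      (1 + R ^ 2 - 2 * R * ⟪e, (y : Space d)⟫) ^ (-(s / 2)) := fun e he ↦
    Continuous.rpow_const (by fun_prop)
      fun y ↦ Or.inl (quad_pos hR' he (norm_eq_of_mem_sphere y)).ne'
  have hn : ‖-axis d‖ = 1 := by rw [norm_neg, norm_axis]
  have h1 := U_eq_integral_quad hd (s := s) ⟨hR.1.le, hR.2.le⟩
  have h2 : U d s R = ∫ y : Sph d,
      (1 + R ^ 2 - 2 * R * ⟪-axis d, (y : Space d)⟫) ^ (-(s / 2)) ∂(sigma d) := by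
    rw [h1, integral_eq_lintegral_of_nonneg_ae _ (hcont _ norm_axis).aestronglyMeasurable,
      integral_eq_lintegral_of_nonneg_ae _ (hcont _ hn).aestronglyMeasurable,
      ← lintegral_sigma_isometry (LinearIsometryEquiv.neg ℝ)
        (g := fun y ↦ ENNReal.ofReal ((1 + R ^ 2 - 2 * R * ⟪axis d, y⟫) ^ (-(s / 2)))) (by fun_prop)]
    · simp
    · exact Filter.Eventually.of_forall fun y ↦
        Real.rpow_nonneg (quad_pos hR' hn (norm_eq_of_mem_sphere y)).le _
    · exact Filter.Eventually.of_forall fun y ↦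
        Real.rpow_nonneg (quad_pos hR' norm_axis (norm_eq_of_mem_sphere y)).le _
  have h3 : U d s R + U d s R ≤ (1 - R) ^ (-s) + (1 + R) ^ (-s) := by
    nth_rewrite 1 [h1]
    rw [h2, ← integral_add (integrable_of_continuous (hcont _ norm_axis))
      (integrable_of_continuous (hcont _ hn))]
    have hc : ∫ _ : Sph d, ((1 - R) ^ (-s) + (1 + R) ^ (-s)) ∂(sigma d) =
        (1 - R) ^ (-s) + (1 + R) ^ (-s) := by simp
    rw [← hc]
    refine integral_mono (integrable_of_continuous ((hcont _ norm_axis).add (hcont _ hn)))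
      (integrable_const _) fun y ↦ ?_
    have hy := norm_eq_of_mem_sphere y
    have ht := abs_le.1 (show |⟪axis d, (y : Space d)⟫| ≤ 1 by
      simpa [norm_axis, hy] using abs_real_inner_le_norm (axis d) (y : Space d))
    have hp1 : (1 - R) ^ (-s) = ((1 - R) ^ 2) ^ (-(s / 2)) := by
      rw [← Real.rpow_natCast, ← Real.rpow_mul (by linarith [hR.2])]; congr 1; push_cast; ring
    have hp2 : (1 + R) ^ (-s) = ((1 + R) ^ 2) ^ (-(s / 2)) := by
      rw [← Real.rpow_natCast, ← Real.rpow_mul (by linarith [hR.1])]; congr 1; push_cast; ring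
    rw [hp1, hp2]
    have hR0 := hR.1
    have hR1 := sub_pos.2 hR.2
    refine rpow_neg_le_of_add_eq (by positivity) (by nlinarith) (by positivity) ?_ ?_ ?_
    · nlinarith
    · rw [inner_neg_left]; nlinarith
    · rw [inner_neg_left]; ring
  linarith

/-! ### Monotonicity, non-convexity and non-concavity of `f` -/

lemma convexOn_Icc_of_Ioo {φ : ℝ → ℝ} (h : ConvexOn ℝ (Ioo 0 1) φ)
    (hc : ContinuousOn φ (Icc 0 1)) : ConvexOn ℝ (Icc 0 1) φ := by
  have hcl : closure (Ioo (0 : ℝ) 1 ×ˢ Ioo (0 : ℝ) 1) = Icc 0 1 ×ˢ Icc 0 1 := by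
    rw [closure_prod_eq, closure_Ioo zero_ne_one]
  refine ⟨convex_Icc 0 1, fun x hx y hy a b ha hb hab ↦ ?_⟩
  have hmaps : ∀ p ∈ Icc (0 : ℝ) 1 ×ˢ Icc (0 : ℝ) 1, a * p.1 + b * p.2 ∈ Icc (0 : ℝ) 1 :=
    fun p hp ↦ convex_Icc 0 1 hp.1 hp.2 ha hb hab
  have key : ∀ p ∈ closure (Ioo (0 : ℝ) 1 ×ˢ Ioo (0 : ℝ) 1),
      φ (a * p.1 + b * p.2) ≤ a * φ p.1 + b * φ p.2 := by
    intro p hp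
    refine le_on_closure (s := Ioo (0 : ℝ) 1 ×ˢ Ioo (0 : ℝ) 1)
      (f := fun p : ℝ × ℝ ↦ φ (a * p.1 + b * p.2)) (g := fun p : ℝ × ℝ ↦ a * φ p.1 + b * φ p.2)
      (fun p hp ↦ h.2 hp.1 hp.2 ha hb hab) ?_ ?_ hp <;> rw [hcl]
    · exact hc.comp (by fun_prop) hmaps
    · exact ((hc.comp continuousOn_fst fun p hp ↦ hp.1).const_mul a).add
        ((hc.comp continuousOn_snd fun p hp ↦ hp.2).const_mul b)
  exact key (x, y) (hcl ▸ ⟨hx, hy⟩)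

lemma continuousOn_f (hd : 1 ≤ d) {s : ℝ} (hs0 : 0 < s) (hs : s < d) :
    ContinuousOn (f d s) (Icc 0 1) := by
  refine ContinuousOn.sub (ContinuousOn.div ?_ (by fun_prop) fun R hR ↦ ?_)
    (continuousOn_U hd hs0 hs)
  · exact ContinuousOn.rpow_const (by fun_prop) fun R _ ↦ Or.inr (by linarith)
  · have := hR.1; positivity

lemma strictAntiOn_f (hd : 1 ≤ d) {s : ℝ} (hs0 : 0 < s) (hs1 : (d : ℝ) - 1 < s) (hs : s < d) :
    StrictAntiOn (f d s) (Icc 0 1) := by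
  intro x hx y hy hxy
  have hU := monotoneOn_U hd hs0 hs1 hs hx hy hxy.le
  have hx0 := hx.1
  have h1 : |y - 1| < |x - 1| := by
    rw [abs_of_nonpos (by linarith [hy.2]), abs_of_nonpos (by linarith [hx.2])]; linarith
  have h2 : |y - 1| ^ ((d : ℝ) - s) < |x - 1| ^ ((d : ℝ) - s) :=
    Real.rpow_lt_rpow (abs_nonneg _) h1 (by linarith)
  have h3 : (x + 1) ^ d ≤ (y + 1) ^ d := by gcongr
  have h4 : |y - 1| ^ ((d : ℝ) - s) / (y + 1) ^ d < |x - 1| ^ ((d : ℝ) - s) / (x + 1) ^ d :=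
    div_lt_div₀ h2 h3 (by positivity) (by positivity)
  simp only [f]
  linarith

lemma f_zero (hd : 1 ≤ d) (s : ℝ) : f d s 0 = 0 := by simp [f, U_zero hd]

lemma f_one {s : ℝ} (hs : s < d) : f d s 1 = -U d s 1 := by
  simp [f, Real.zero_rpow (sub_pos.2 hs).ne']

lemma f_lower (hd : 1 ≤ d) {s : ℝ} (hs0 : 0 < s) (hs1 : (d : ℝ) - 1 < s) (hs : s < d) {R : ℝ}
    (hR : R ∈ Icc (0 : ℝ) 1) : (1 - R) ^ ((d : ℝ) - s) / 2 ^ d - U d s 1 ≤ f d s R := by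
  have h1 := monotoneOn_U hd hs0 hs1 hs hR (right_mem_Icc.2 zero_le_one) hR.2
  have h2 : 0 ≤ 1 - R := sub_nonneg.2 hR.2
  have h3 := hR.1
  rw [f, abs_sub_comm, abs_of_nonneg h2]
  gcongr
  linarith [hR.2]

/-- At `R = 1` the graph of `f` has a vertical tangent: `f (1 - ε) - f 1` is at least of order `ε ^
(d - s)` with `d - s < 1`, whereas a convex function lies below its chord over `[1/2, 1]`, so its
increment there is at most linear in `ε`. -/
lemma not_convexOn_f (hd : 1 ≤ d) {s : ℝ} (hs0 : 0 < s) (hs1 : (d : ℝ) - 1 < s) (hs : s < d) :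
    ¬ ConvexOn ℝ (Ioo 0 1) (f d s) := by
  intro h
  have h' := convexOn_Icc_of_Ioo h (continuousOn_f hd hs0 hs)
  have key : ∀ ε ∈ Ioo (0 : ℝ) (1 / 2), 1 ≤ 2 ^ (d + 1) * U d s 1 * ε ^ (1 - (d - s)) := by
    intro ε hε
    have hε0 := hε.1
    have h1 := h'.2 (show (1 / 2 : ℝ) ∈ Icc 0 1 by norm_num) (right_mem_Icc.2 zero_le_one)
      (show 0 ≤ 2 * ε by linarith) (show 0 ≤ 1 - 2 * ε by linarith [hε.2]) (by ring)
    have h2 := f_lower hd hs0 hs1 hs (R := 1 - ε) ⟨by linarith [hε.2], by linarith⟩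
    have h3 : f d s (1 / 2) ≤ 0 := by
      rw [← f_zero hd s]
      exact (strictAntiOn_f hd hs0 hs1 hs (by norm_num) (by norm_num) (by norm_num)).le
    rw [smul_eq_mul, smul_eq_mul, smul_eq_mul, smul_eq_mul, f_one hs,
      show 2 * ε * (1 / 2) + (1 - 2 * ε) * 1 = 1 - ε by ring] at h1
    rw [sub_sub_cancel] at h2
    have h4 : ε ^ ((d : ℝ) - s) / 2 ^ d ≤ 2 * ε * U d s 1 := by nlinarith
    rw [div_le_iff₀ (by positivity)] at h4
    rw [Real.rpow_sub hε0, Real.rpow_one, mul_div_assoc', le_div_iff₀ (by positivity), pow_succ]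
    linarith
  have ht : Filter.Tendsto (fun ε : ℝ ↦ 2 ^ (d + 1) * U d s 1 * ε ^ (1 - (d - s)))
      (nhdsWithin 0 (Ioi 0)) (nhds 0) := by
    have h1 : Filter.Tendsto (fun ε : ℝ ↦ 2 ^ (d + 1) * U d s 1 * ε ^ (1 - (d - s))) (nhds 0)
        (nhds (2 ^ (d + 1) * U d s 1 * 0 ^ (1 - (d - s)))) :=
      ((Real.continuousAt_rpow_const 0 _ (Or.inr (by linarith))).tendsto).const_mul _
    rw [Real.zero_rpow (by linarith), mul_zero] at h1
    exact h1.mono_left nhdsWithin_le_nhds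
  have := ge_of_tendsto ht (Filter.mem_of_superset (Ioo_mem_nhdsGT (by norm_num)) key)
  linarith

/-- `(1 - R)^p (1 + R)^r`. -/
noncomputable def jacobiWeight (p r R : ℝ) : ℝ := (1 - R) ^ p * (1 + R) ^ r

lemma jacobiWeight_zero (p r : ℝ) : jacobiWeight p r 0 = 1 := by simp [jacobiWeight]

lemma hasDerivAt_jacobiWeight (p r : ℝ) {R : ℝ} (hR : R ∈ Ioo (-1 : ℝ) 1) :
    HasDerivAt (jacobiWeight p r) (-p * jacobiWeight (p - 1) r R + r * jacobiWeight p (r - 1) R)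
      R := by
  have h1 : HasDerivAt (fun R : ℝ ↦ (1 - R) ^ p) _ R :=
    ((hasDerivAt_id' R).const_sub 1).rpow_const (Or.inl (by linarith [hR.2]))
  have h2 : HasDerivAt (fun R : ℝ ↦ (1 + R) ^ r) _ R :=
    ((hasDerivAt_id' R).const_add 1).rpow_const (Or.inl (by linarith [hR.1]))
  refine (h1.mul h2).congr_deriv ?_
  simp only [jacobiWeight]
  ring

lemma f_eq_jacobiWeight {s R : ℝ} (hR : R ∈ Icc (0 : ℝ) 1) :
    f d s R = jacobiWeight (d - s) (-d) R - U d s R := by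
  rw [f, jacobiWeight, abs_sub_comm, abs_of_nonneg (by linarith [hR.2]),
    Real.rpow_neg (by linarith [hR.1]), Real.rpow_natCast, div_eq_mul_inv, add_comm R 1]

/-- Second-order test at `0`: the derivative is positive just to the right of `0`, and the mean
value theorem transfers this to `k`. -/
lemma exists_pos_of_hasDerivAt_pos {k k' : ℝ → ℝ} {c : ℝ}
    (hk : ∀ x ∈ Ioo (-1 : ℝ) 1, HasDerivAt k (k' x) x) (h0 : k 0 = 0) (h0' : k' 0 = 0)
    (hk' : HasDerivAt k' c 0) (hc : 0 < c) : ∃ x ∈ Ioo (0 : ℝ) 1, 0 < k x := by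
  have h1 : ∀ᶠ x in nhdsWithin (0 : ℝ) (Ioi 0), 0 < k' x := by
    have h2 := (hasDerivAt_iff_tendsto_slope.1 hk').mono_left
      (nhdsWithin_mono 0 (fun x (hx : x ∈ Ioi 0) ↦ ne_of_gt hx))
    filter_upwards [h2.eventually (lt_mem_nhds hc), self_mem_nhdsWithin] with x hx hx0
    rw [slope_def_field, h0', sub_zero, sub_zero] at hx
    exact (div_pos_iff_of_pos_right hx0).1 hx
  obtain ⟨δ, hδ, hsub⟩ := mem_nhdsGT_iff_exists_Ioo_subset.1 h1
  have hδ0 : (0 : ℝ) < δ := hδ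
  set x := min δ (1 / 2)
  have hx0 : 0 < x := lt_min hδ0 (by norm_num)
  have hx1 : x < 1 := (min_le_right _ _).trans_lt (by norm_num)
  obtain ⟨ξ, hξ, he⟩ := exists_hasDerivAt_eq_slope k k' hx0
    (fun y hy ↦ (hk y ⟨by linarith [hy.1], by linarith [hy.2]⟩).continuousAt.continuousWithinAt)
    (fun y hy ↦ hk y ⟨by linarith [hy.1], by linarith [hy.2]⟩)
  have h3 : 0 < k' ξ := hsub ⟨hξ.1, hξ.2.trans_le (min_le_left _ _)⟩
  rw [he, h0, sub_zero, sub_zero, div_pos_iff_of_pos_right hx0] at h3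
  exact ⟨x, ⟨hx0, hx1⟩, h3⟩

/-- A concave `f` would stay below the line of slope `-(2d - s)` through the origin. But `U_le`
gives a minorant of `f` that is tangent to this line at `0` and has positive second derivative
there. -/
lemma not_concaveOn_f (hd : 1 ≤ d) {s : ℝ} (hs0 : 0 < s) (hs1 : (d : ℝ) - 1 < s) (hs : s < d) :
    ¬ ConcaveOn ℝ (Ioo 0 1) (f d s) := by
  intro h
  have h' := convexOn_Icc_of_Ioo h.neg (continuousOn_f hd hs0 hs).neg
  have hdpos : (0 : ℝ) < d := by linarith
  -- As `U ≥ U(0) = 1`, an explicit majorant that also vanishes at `0` supplies the slope there, and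
  -- `U` need not be differentiated at `0`.
  have hle : ∀ x ∈ Icc (0 : ℝ) 1, f d s x ≤ jacobiWeight (d - s) (-d) x - 1 := by
    intro x hx
    have := monotoneOn_U hd hs0 hs1 hs (left_mem_Icc.2 zero_le_one) hx hx.1
    rw [U_zero hd] at this
    rw [f_eq_jacobiWeight hx]
    linarith
  -- concavity puts `f` below its tangent at `0`
  have htan : ∀ R ∈ Ioo (0 : ℝ) 1, f d s R ≤ -(2 * d - s) * R := by
    intro R hR
    have hg := hasDerivAt_jacobiWeight (d - s) (-d) (R := 0) (by norm_num)
    rw [jacobiWeight_zero, jacobiWeight_zero] at hg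
    have hsl := (hasDerivAt_iff_tendsto_slope.1 hg).mono_left
      (nhdsWithin_mono 0 (fun x (hx : x ∈ Ioi 0) ↦ ne_of_gt hx))
    have h1 : f d s R / R ≤ -((d : ℝ) - s) * 1 + -d * 1 := by
      refine ge_of_tendsto hsl (Filter.mem_of_superset (Ioo_mem_nhdsGT hR.1) fun x hx ↦ ?_)
      have hx0 := hx.1
      have hR0 := hR.1
      have h2 := h'.2 (show R ∈ Icc 0 1 from ⟨hR.1.le, hR.2.le⟩) (left_mem_Icc.2 zero_le_one)
        (show 0 ≤ x / R by positivity)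
        (sub_nonneg.2 ((div_le_one hR0).2 hx.2.le)) (by ring)
      simp only [smul_eq_mul, mul_zero, add_zero, Pi.neg_apply, f_zero hd, neg_zero,
        div_mul_cancel₀ x hR0.ne'] at h2
      have h3 := hle x ⟨hx0.le, (hx.2.trans hR.2).le⟩
      simp only [mem_ofPred_eq, slope_def_field, jacobiWeight_zero, sub_zero]
      rw [le_div_iff₀ hx0]
      have h4 : f d s R / R * x = x / R * f d s R := by ring
      linarith
    rw [div_le_iff₀ hR.1] at h1
    linarith
  -- The minorant of `f` minus the tangent line.
  set k : ℝ → ℝ := fun R ↦ jacobiWeight (d - s) (-d) R -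
    (jacobiWeight (-s) 0 R + jacobiWeight 0 (-s) R) / 2 + (2 * d - s) * R with hkdef
  have hk : ∀ R ∈ Ioo (-1 : ℝ) 1, HasDerivAt k _ R := fun R hR ↦
    ((hasDerivAt_jacobiWeight (d - s) (-d) hR).sub
      (((hasDerivAt_jacobiWeight (-s) 0 hR).add
        (hasDerivAt_jacobiWeight 0 (-s) hR)).div_const 2)).add
      ((hasDerivAt_id' R).const_mul (2 * (d : ℝ) - s))
  have hz : (0 : ℝ) ∈ Ioo (-1 : ℝ) 1 := by norm_num
  have hD : ∀ p r : ℝ, HasDerivAt (jacobiWeight p r) (r - p) 0 := fun p r ↦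
    (hasDerivAt_jacobiWeight p r hz).congr_deriv (by rw [jacobiWeight_zero, jacobiWeight_zero]; ring)
  -- Here `c` is the second derivative of `k` at `0`, namely `(2d - s)² + s - s(s + 1)`.
  obtain ⟨x, hx, hpos⟩ := exists_pos_of_hasDerivAt_pos (c := 4 * d * (d - s)) hk
    (by simp only [hkdef, jacobiWeight_zero]; ring) (by simp only [jacobiWeight_zero]; ring)
    (((((((hD _ _).const_mul _).add ((hD _ _).const_mul _)).sub
      (((((hD _ _).const_mul _).add ((hD _ _).const_mul _)).add
        (((hD _ _).const_mul _).add ((hD _ _).const_mul _))).div_const 2)).add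
      (hasDerivAt_const _ _))).congr_deriv (by ring)) (by have := sub_pos.2 hs; positivity)
  have h1 := htan x hx
  have h2 := U_le hd hs0 hx
  rw [f_eq_jacobiWeight ⟨hx.1.le, hx.2.le⟩] at h1
  have h3 : jacobiWeight (-s) 0 x = (1 - x) ^ (-s) := by simp [jacobiWeight]
  have h4 : jacobiWeight 0 (-s) x = (1 + x) ^ (-s) := by simp [jacobiWeight]
  simp only [hkdef, h3, h4] at hpos
  linarith

/-! ### Energy minimality of the surface measure -/

/-- The Gaussian kernel, as an extended nonnegative number. -/
noncomputable def gauss (t : ℝ) (x y : Space d) : ENNReal :=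
  ENNReal.ofReal (Real.exp (-t * dist x y ^ 2))

lemma measurable_gauss {α : Type*} [MeasurableSpace α] {t : α → ℝ} {x y : α → Space d}
    (ht : Measurable t) (hx : Measurable x) (hy : Measurable y) :
    Measurable fun a ↦ gauss (t a) (x a) (y a) :=
  (((ht.neg.mul ((hx.dist hy).pow_const 2))).exp).ennreal_ofReal

/-- By the parallelogram law around the midpoint of `x` and `y`, a Gaussian is, up to a constant, a
convolution of two narrower ones. This is what makes it positive definite. -/
lemma lintegral_gauss_mul_gauss (t : ℝ) (x y : Space d) :
    ∫⁻ z, gauss (2 * t) x z * gauss (2 * t) y z =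
      (∫⁻ z : Space d, ENNReal.ofReal (Real.exp (-4 * t * ‖z‖ ^ 2))) * gauss t x y := by
  rw [← lintegral_mul_const _ (by fun_prop),
    ← lintegral_sub_right_eq_self (fun z : Space d ↦
      ENNReal.ofReal (Real.exp (-4 * t * ‖z‖ ^ 2)) * gauss t x y) ((1 / 2 : ℝ) • (x + y))]
  refine lintegral_congr fun z ↦ ?_
  simp only [gauss]
  rw [← ENNReal.ofReal_mul (Real.exp_nonneg _), ← ENNReal.ofReal_mul (Real.exp_nonneg _),
    ← Real.exp_add, ← Real.exp_add]
  congr 2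
  have h : ‖x - z‖ ^ 2 + ‖y - z‖ ^ 2 =
      2 * ‖z - (1 / 2 : ℝ) • (x + y)‖ ^ 2 + ‖x - y‖ ^ 2 / 2 := by
    simp only [norm_sub_sq_real, norm_smul, mul_pow, inner_smul_right, inner_add_right,
      norm_add_sq_real, real_inner_comm z]
    norm_num
    ring
  rw [dist_eq_norm, dist_eq_norm, dist_eq_norm]
  linear_combination (-2 * t) * h

lemma ennreal_two_mul_le (a b : ENNReal) : 2 * (a * b) ≤ a * a + b * b := by
  wlog h : a ≤ b generalizing a b
  · rw [mul_comm a b, add_comm (a * a)]; exact this b a (le_of_not_ge h)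
  obtain ⟨c, rfl⟩ := exists_add_of_le h
  calc 2 * (a * (a + c)) ≤ 2 * (a * (a + c)) + c * c := le_self_add
    _ = a * a + (a + c) * (a + c) := by ring

lemma two_mul_lintegral_mul_le {α : Type*} [MeasurableSpace α] {μ : Measure α} {A B : α → ENNReal}
    (hA : Measurable A) (hB : Measurable B) :
    2 * ∫⁻ z, A z * B z ∂μ ≤ ∫⁻ z, A z * A z ∂μ + ∫⁻ z, B z * B z ∂μ := by
  have h1 : ∫⁻ z, 2 * (A z * B z) ∂μ = 2 * ∫⁻ z, A z * B z ∂μ := lintegral_const_mul _ (hA.mul hB)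
  have h2 : ∫⁻ z, (A z * A z + B z * B z) ∂μ = ∫⁻ z, A z * A z ∂μ + ∫⁻ z, B z * B z ∂μ :=
    lintegral_add_left (hA.mul hA) _
  rw [← h1, ← h2]
  exact lintegral_mono fun z ↦ ennreal_two_mul_le _ _

/-- The mutual Gaussian energy of two measures on the sphere. -/
noncomputable def gaussEnergy (t : ℝ) (μ ν : Measure (Sph d)) : ENNReal :=
  ∫⁻ x : Sph d, ∫⁻ y : Sph d, gauss t (x : Space d) (y : Space d) ∂ν ∂μ

/-- Up to a constant, the mutual energy is the `L²` inner product of the two measures smoothed by a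
Gaussian. -/
lemma gaussEnergy_factor (t : ℝ) (μ ν : Measure (Sph d)) [SFinite μ] [SFinite ν] :
    (∫⁻ z : Space d, ENNReal.ofReal (Real.exp (-4 * t * ‖z‖ ^ 2))) * gaussEnergy t μ ν =
      ∫⁻ z, (∫⁻ x : Sph d, gauss (2 * t) (x : Space d) z ∂μ) * (∫⁻ y : Sph d, gauss (2 * t) (y : Space d) z ∂ν) := by
  have hg : ∀ z : Space d, Measurable fun y : Sph d ↦ gauss (2 * t) (y : Space d) z := fun z ↦
    measurable_gauss measurable_const measurable_subtype_coe measurable_const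
  have hm : Measurable fun p : Sph d × Sph d ↦ gauss t (p.1 : Space d) (p.2 : Space d) :=
    measurable_gauss measurable_const (by fun_prop) (by fun_prop)
  have hm1 : Measurable fun x : Sph d ↦ ∫⁻ y : Sph d, gauss t (x : Space d) y ∂ν :=
    hm.lintegral_prod_right'
  have hm3 : Measurable fun p : Sph d × Space d ↦ gauss (2 * t) (p.1 : Space d) p.2 :=
    measurable_gauss measurable_const (by fun_prop) (by fun_prop)
  rw [gaussEnergy, ← lintegral_const_mul _ hm1]
  have h1 : ∀ x : Sph d, (∫⁻ z : Space d, ENNReal.ofReal (Real.exp (-4 * t * ‖z‖ ^ 2))) *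
      ∫⁻ y : Sph d, gauss t (x : Space d) y ∂ν =
      ∫⁻ z, gauss (2 * t) (x : Space d) z * ∫⁻ y : Sph d, gauss (2 * t) (y : Space d) z ∂ν := by
    intro x
    rw [← lintegral_const_mul _ (measurable_gauss measurable_const measurable_const
      measurable_subtype_coe)]
    simp only [← lintegral_gauss_mul_gauss, ← lintegral_const_mul _ (hg _)]
    refine lintegral_lintegral_swap ?_
    exact ((measurable_gauss measurable_const measurable_const measurable_snd).mul
      hm3).aemeasurable
  simp only [h1, ← lintegral_mul_const _ (hg _)]
  refine lintegral_lintegral_swap ?_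
  exact (hm3.mul ((Measurable.lintegral_prod_left' hm3).comp measurable_snd)).aemeasurable

lemma gaussPotential_sigma_const (t : ℝ) {x : Space d} (hx : ‖x‖ = 1) :
    ∫⁻ y : Sph d, gauss t x y ∂(sigma d) = ∫⁻ y : Sph d, gauss t (axis d) y ∂(sigma d) := by
  obtain ⟨L, hL⟩ := exists_isometry_eq (norm_axis.trans hx.symm)
  rw [← hL, ← lintegral_sigma_isometry L (g := gauss t (L (axis d)))
    (measurable_gauss measurable_const measurable_const measurable_id)]
  simp only [gauss, L.dist_map]

lemma gaussEnergy_sigma (t : ℝ) (μ : Measure (Sph d)) [IsProbabilityMeasure μ] :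
    gaussEnergy t μ (sigma d) = ∫⁻ y : Sph d, gauss t (axis d) y ∂(sigma d) := by
  simp only [gaussEnergy, gaussPotential_sigma_const t (norm_eq_of_mem_sphere _), lintegral_const,
    measure_univ, mul_one]

/-- The Gaussian potential of `sigma d` is constant on the sphere, so its mutual energy with `μ`
equals its own energy. The inequality `2⟨a, b⟩ ≤ ⟨a, a⟩ + ⟨b, b⟩` for the smoothed measures then
gives the claim once this finite quantity is cancelled. -/
lemma gaussEnergy_sigma_le {t : ℝ} (ht : 0 < t) (μ : Measure (Sph d)) [IsProbabilityMeasure μ] :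
    gaussEnergy t (sigma d) (sigma d) ≤ gaussEnergy t μ μ := by
  set c := ∫⁻ z : Space d, ENNReal.ofReal (Real.exp (-4 * t * ‖z‖ ^ 2)) with hc
  have hc0 : c ≠ 0 := by
    rw [hc, Ne, lintegral_eq_zero_iff (by fun_prop)]
    intro h
    obtain ⟨z, hz⟩ := h.exists
    simp only [Pi.zero_apply, ENNReal.ofReal_eq_zero] at hz
    exact absurd (Real.exp_pos (-4 * t * ‖z‖ ^ 2)) (not_lt.2 hz)
  have hct : c ≠ ⊤ := by
    have h1 : Integrable fun z : Space d ↦ Real.exp (-(4 * t) * ‖z‖ ^ 2) := by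
      refine Integrable.of_integral_ne_zero ?_
      rw [GaussianFourier.integral_rexp_neg_mul_sq_norm (by positivity)]
      positivity
    have := h1.lintegral_lt_top
    simp only [neg_mul] at this hc ⊢
    rw [hc]
    exact this.ne
  have hfin : gaussEnergy t μ (sigma d) ≠ ⊤ := by
    rw [gaussEnergy_sigma]
    refine ne_top_of_le_ne_top ENNReal.one_ne_top ?_
    refine (lintegral_mono (g := fun _ ↦ 1) fun y ↦ ?_).trans (by simp)
    rw [gauss, ← ENNReal.ofReal_one]
    refine ENNReal.ofReal_le_ofReal (Real.exp_le_one_iff.2 ?_)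
    nlinarith [sq_nonneg (dist (axis d) (y : Space d))]
  have h1 : 2 * (c * gaussEnergy t μ (sigma d)) ≤
      c * gaussEnergy t μ μ + c * gaussEnergy t (sigma d) (sigma d) := by
    rw [hc, gaussEnergy_factor, gaussEnergy_factor, gaussEnergy_factor]
    have hm : ∀ ν : Measure (Sph d), SFinite ν → Measurable fun z : Space d ↦
        ∫⁻ x : Sph d, gauss (2 * t) (x : Space d) z ∂ν := fun ν _ ↦
      Measurable.lintegral_prod_left' (f := fun p : Sph d × Space d ↦ gauss (2 * t) (p.1 : Space d) p.2)
        (measurable_gauss measurable_const (by fun_prop) (by fun_prop))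
    exact two_mul_lintegral_mul_le (hm μ inferInstance) (hm (sigma d) inferInstance)
  rw [← mul_add, mul_left_comm, ENNReal.mul_le_mul_iff_right hc0 hct, gaussEnergy_sigma t (sigma d),
    ← gaussEnergy_sigma t μ, two_mul] at h1
  rw [gaussEnergy_sigma t (sigma d), ← gaussEnergy_sigma t μ]
  exact (ENNReal.add_le_add_iff_right hfin).1 h1

/-- Euler's integral for `Γ(s / 2)`: the Riesz kernel is a positive superposition of Gaussians. -/
lemma lintegral_gauss_rpow {s : ℝ} (hs0 : 0 < s) {x y : Space d} (h : x ≠ y) :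
    ∫⁻ t in Ioi (0 : ℝ), ENNReal.ofReal (t ^ (s / 2 - 1)) * gauss t x y =
      ENNReal.ofReal (Real.Gamma (s / 2)) * edist x y ^ (-s) := by
  have hr : 0 < dist x y ^ 2 := by have := dist_pos.2 h; positivity
  have h1 := Real.integral_rpow_mul_exp_neg_mul_Ioi (half_pos hs0) hr
  have hG := Real.Gamma_pos_of_pos (half_pos hs0)
  have h2 : ∀ t ∈ Ioi (0 : ℝ), ENNReal.ofReal (t ^ (s / 2 - 1)) * gauss t x y =
      ENNReal.ofReal (t ^ (s / 2 - 1) * Real.exp (-(dist x y ^ 2 * t))) := by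
    intro t ht
    rw [gauss, ← ENNReal.ofReal_mul (Real.rpow_nonneg (le_of_lt ht) _)]
    ring_nf
  rw [setLIntegral_congr_fun measurableSet_Ioi h2, ← ofReal_integral_eq_lintegral_ofReal, h1,
    edist_rpow_neg h, ← ENNReal.ofReal_mul hG.le]
  · congr 1
    rw [mul_comm, one_div, Real.inv_rpow hr.le, ← Real.rpow_natCast, ← Real.rpow_mul dist_nonneg,
      ← Real.rpow_neg dist_nonneg]
    congr 2
    push_cast
    ring
  · refine Integrable.of_integral_ne_zero ?_
    rw [h1]
    positivity
  · filter_upwards [self_mem_ae_restrict measurableSet_Ioi] with t ht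
    exact mul_nonneg (Real.rpow_nonneg (le_of_lt ht) _) (Real.exp_nonneg _)

lemma lintegral_gaussEnergy (s : ℝ) (μ : Measure (Sph d)) [SFinite μ] :
    ∫⁻ t in Ioi (0 : ℝ), ENNReal.ofReal (t ^ (s / 2 - 1)) * gaussEnergy t μ μ =
      ∫⁻ x : Sph d, ∫⁻ y : Sph d,
        (∫⁻ t in Ioi (0 : ℝ), ENNReal.ofReal (t ^ (s / 2 - 1)) * gauss t (x : Space d) y) ∂μ ∂μ := by
  have hm2 : Measurable fun p : (ℝ × Sph d) × Sph d ↦ ENNReal.ofReal (p.1.1 ^ (s / 2 - 1)) *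
      gauss p.1.1 (p.1.2 : Space d) (p.2 : Space d) :=
    Measurable.mul (by fun_prop) (measurable_gauss (by fun_prop) (by fun_prop) (by fun_prop))
  have hm1 : Measurable fun p : ℝ × Sph d ↦ ∫⁻ y : Sph d, ENNReal.ofReal (p.1 ^ (s / 2 - 1)) *
      gauss p.1 (p.2 : Space d) (y : Space d) ∂μ := hm2.lintegral_prod_right'
  have h1 : ∀ t, ENNReal.ofReal (t ^ (s / 2 - 1)) * gaussEnergy t μ μ =
      ∫⁻ x : Sph d, ∫⁻ y : Sph d, ENNReal.ofReal (t ^ (s / 2 - 1)) * gauss t (x : Space d) y ∂μ ∂μ := by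
    intro t
    have hm : Measurable fun p : Sph d × Sph d ↦ gauss t (p.1 : Space d) (p.2 : Space d) :=
      measurable_gauss measurable_const (by fun_prop) (by fun_prop)
    rw [gaussEnergy, ← lintegral_const_mul _ hm.lintegral_prod_right']
    refine lintegral_congr fun x ↦ ?_
    have hmx : Measurable fun y : Sph d ↦ gauss t (x : Space d) y :=
      measurable_gauss measurable_const measurable_const measurable_subtype_coe
    exact (lintegral_const_mul _ hmx).symm
  simp only [h1]
  rw [lintegral_lintegral_swap hm1.aemeasurable]
  refine lintegral_congr fun x ↦ ?_
  refine lintegral_lintegral_swap (Measurable.aemeasurable ?_)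
  exact hm2.comp (by fun_prop : Measurable fun p : ℝ × Sph d ↦ ((p.1, x), p.2))

lemma rieszEnergy_sigma (s : ℝ) :
    rieszEnergy s (sigma d) = rieszPotential s (sigma d) (axis d) := by
  simp only [rieszEnergy, rieszPotential_sigma_const s (norm_eq_of_mem_sphere _), lintegral_const,
    measure_univ, mul_one]

/-- The normalized surface measure minimizes the Riesz energy. -/
lemma rieszEnergy_sigma_le (hd : 1 ≤ d) {s : ℝ} (hs0 : 0 < s) (μ : Measure (Sph d))
    [IsProbabilityMeasure μ] : rieszEnergy s (sigma d) ≤ rieszEnergy s μ := by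
  have hG : ENNReal.ofReal (Real.Gamma (s / 2)) ≠ 0 := by
    simpa using Real.Gamma_pos_of_pos (half_pos hs0)
  rw [← ENNReal.mul_le_mul_iff_right hG ENNReal.ofReal_ne_top]
  have hk : Measurable fun p : Sph d × Sph d ↦ edist (p.1 : Space d) (p.2 : Space d) ^ (-s) := by
    fun_prop
  have hE : ∀ ν : Measure (Sph d), SFinite ν → ENNReal.ofReal (Real.Gamma (s / 2)) *
      rieszEnergy s ν = ∫⁻ x : Sph d, ∫⁻ y : Sph d, ENNReal.ofReal (Real.Gamma (s / 2)) *
        edist (x : Space d) (y : Space d) ^ (-s) ∂ν ∂ν := by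
    intro ν _
    simp only [rieszEnergy, rieszPotential]
    rw [← lintegral_const_mul _ hk.lintegral_prod_right']
    refine lintegral_congr fun x ↦ ?_
    have hkx : Measurable fun y : Sph d ↦ edist (x : Space d) (y : Space d) ^ (-s) :=
      (measurable_kernel s (x : Space d)).comp measurable_subtype_coe
    exact (lintegral_const_mul _ hkx).symm
  rw [hE _ inferInstance, hE _ inferInstance]
  calc _ = ∫⁻ x : Sph d, ∫⁻ y : Sph d, (∫⁻ t in Ioi (0 : ℝ),
        ENNReal.ofReal (t ^ (s / 2 - 1)) * gauss t (x : Space d) y) ∂(sigma d) ∂(sigma d) := by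
        refine lintegral_congr fun x ↦ lintegral_congr_ae ?_
        filter_upwards [ae_ne_sigma hd x] with y hy
        rw [lintegral_gauss_rpow hs0 hy]
    _ = _ := (lintegral_gaussEnergy s (sigma d)).symm
    _ ≤ ∫⁻ t in Ioi (0 : ℝ), ENNReal.ofReal (t ^ (s / 2 - 1)) * gaussEnergy t μ μ :=
        setLIntegral_mono' measurableSet_Ioi fun t ht ↦ by
          gcongr; exact gaussEnergy_sigma_le ht μ
    _ = _ := lintegral_gaussEnergy s μ
    _ ≤ _ := by
        refine lintegral_mono fun x ↦ lintegral_mono fun y ↦ ?_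
        -- An arbitrary `μ` may charge the diagonal, but there the Riesz kernel is infinite and the
        -- inequality is all that is needed.
        by_cases h : (x : Space d) = y
        · rw [h, edist_self, ENNReal.zero_rpow_of_neg (by linarith), ENNReal.mul_top hG]
          exact le_top
        · exact (lintegral_gauss_rpow hs0 h).le

lemma W_eq (hd : 1 ≤ d) {s : ℝ} (hs0 : 0 < s) : W d s = U d s 1 := by
  rw [W, U, one_smul, ← rieszEnergy_sigma]
  congr 1
  exact le_antisymm (iInf_le _ (⟨sigma d, inferInstance⟩ : ProbabilityMeasure (Sph d)))
    (le_iInf fun μ ↦ rieszEnergy_sigma_le hd hs0 _)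

lemma W_pos (hd : 1 ≤ d) {s : ℝ} (hs0 : 0 < s) (hs1 : (d : ℝ) - 1 < s) (hs : s < d) :
    0 < W d s := by
  have := monotoneOn_U hd hs0 hs1 hs (left_mem_Icc.2 zero_le_one) (right_mem_Icc.2 zero_le_one)
    zero_le_one
  rw [U_zero hd] at this
  rw [W_eq hd hs0]
  linarith

/-- The constant value on the sphere of the potential of `σ_d`. -/
lemma rieszPotential_sigma_axis (hd : 1 ≤ d) {s : ℝ} (hs0 : 0 < s) (hs : s < d) :
    rieszPotential s (sigma d) (axis d) = ENNReal.ofReal (W d s) := by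
  rw [W_eq hd hs0, U, one_smul, ENNReal.ofReal_toReal]
  exact (rieszPotential_sigma_lt_top hd hs0 hs (northPole d)).ne

/-! ### Uniqueness of the signed equilibrium -/

/-- Pairing of a potential with the density of a balayage measure. -/
lemma lintegral_rieszPotential_mul_conf (hd : 1 ≤ d) {s R : ℝ} (hs0 : 0 < s) (hs : s < d)
    (hR : R ∈ Ioo (-1 : ℝ) 1) {e : Space d} (he : ‖e‖ = 1) (μ : Measure (Sph d)) [SFinite μ] :
    ∫⁻ x : Sph d, rieszPotential s μ (x : Space d) * ENNReal.ofReal (conf R e x ^ (s / 2 - d))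
      ∂(sigma d) =
      ENNReal.ofReal (W d s) * ∫⁻ y : Sph d, ENNReal.ofReal (conf R e y ^ (-(s / 2))) ∂μ := by
  have hw : Measurable fun x : Sph d ↦ ENNReal.ofReal (conf R e x ^ (s / 2 - d)) :=
    (continuous_conf_rpow hR he _).measurable.ennreal_ofReal
  have hk : Measurable fun p : Sph d × Sph d ↦ edist (p.1 : Space d) (p.2 : Space d) ^ (-s) := by
    fun_prop
  have h1 : ∀ x : Sph d, rieszPotential s μ (x : Space d) *
      ENNReal.ofReal (conf R e x ^ (s / 2 - d)) = ∫⁻ y : Sph d,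
        edist (x : Space d) (y : Space d) ^ (-s) * ENNReal.ofReal (conf R e x ^ (s / 2 - d)) ∂μ := by
    intro x
    have hkx : Measurable fun y : Sph d ↦ edist (x : Space d) (y : Space d) ^ (-s) :=
      (measurable_kernel s (x : Space d)).comp measurable_subtype_coe
    exact (lintegral_mul_const _ hkx).symm
  simp only [h1]
  rw [lintegral_lintegral_swap (hk.mul (hw.comp measurable_fst)).aemeasurable]
  rw [← lintegral_const_mul _ (continuous_conf_rpow hR he _).measurable.ennreal_ofReal]
  refine lintegral_congr fun y ↦ ?_
  simp only [edist_comm _ (y : Space d)]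
  rw [lintegral_kernel_conf hR he (norm_eq_of_mem_sphere y), rieszPotential_sigma_axis hd hs0 hs]

lemma measurable_rieszPotential (s : ℝ) (μ : Measure (Sph d)) [SFinite μ] :
    Measurable fun x : Sph d ↦ rieszPotential s μ (x : Space d) := by
  have hk : Measurable fun p : Sph d × Sph d ↦ edist (p.1 : Space d) (p.2 : Space d) ^ (-s) := by
    fun_prop
  exact hk.lintegral_prod_right'

/-- The extended-valued pairing has a finite right-hand side, so the integrand is almost everywhere
finite and nothing is lost in passing to real values. -/
lemma integral_rieszPotential_mul_conf (hd : 1 ≤ d) {s R : ℝ} (hs0 : 0 < s)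
    (hs1 : (d : ℝ) - 1 < s) (hs : s < d)
    (hR : R ∈ Ioo (-1 : ℝ) 1) {e : Space d} (he : ‖e‖ = 1) (μ : Measure (Sph d))
    [IsFiniteMeasure μ] :
    Integrable (fun x : Sph d ↦ (rieszPotential s μ (x : Space d)).toReal *
      conf R e x ^ (s / 2 - d)) (sigma d) ∧
    ∫ x : Sph d, (rieszPotential s μ (x : Space d)).toReal * conf R e x ^ (s / 2 - d) ∂(sigma d) =
      W d s * ∫ y : Sph d, conf R e y ^ (-(s / 2)) ∂μ := by
  have hpos : ∀ y : Sph d, 0 < conf R e y := fun y ↦ conf_pos hR he (norm_eq_of_mem_sphere y)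
  have h1 := lintegral_rieszPotential_mul_conf hd hs0 hs hR he μ
  have hi : Integrable (fun y : Sph d ↦ conf R e y ^ (-(s / 2))) μ :=
    integrable_of_continuous (continuous_conf_rpow hR he _)
  have hnn : 0 ≤ ∫ y : Sph d, conf R e y ^ (-(s / 2)) ∂μ :=
    integral_nonneg fun y ↦ Real.rpow_nonneg (hpos y).le _
  rw [← ofReal_integral_eq_lintegral_ofReal hi
    (Filter.Eventually.of_forall fun y ↦ Real.rpow_nonneg (hpos y).le _),
    ← ENNReal.ofReal_mul (W_pos hd hs0 hs1 hs).le] at h1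
  have hm : AEMeasurable (fun x : Sph d ↦ rieszPotential s μ (x : Space d) *
      ENNReal.ofReal (conf R e x ^ (s / 2 - d))) (sigma d) :=
    ((measurable_rieszPotential s μ).mul
      (continuous_conf_rpow hR he _).measurable.ennreal_ofReal).aemeasurable
  have hlt : ∫⁻ x : Sph d, rieszPotential s μ (x : Space d) *
      ENNReal.ofReal (conf R e x ^ (s / 2 - d)) ∂(sigma d) ≠ ⊤ := by
    rw [h1]; exact ENNReal.ofReal_ne_top
  have heq : ∀ x : Sph d, (rieszPotential s μ (x : Space d)).toReal * conf R e x ^ (s / 2 - d) =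
      (rieszPotential s μ (x : Space d) * ENNReal.ofReal (conf R e x ^ (s / 2 - d))).toReal := by
    intro x
    rw [ENNReal.toReal_mul, ENNReal.toReal_ofReal (Real.rpow_nonneg (hpos x).le _)]
  simp only [heq]
  refine ⟨integrable_toReal_of_lintegral_ne_top hm hlt, ?_⟩
  rw [integral_toReal hm (ae_lt_top' hm hlt), h1, ENNReal.toReal_ofReal]
  exact mul_nonneg (W_pos hd hs0 hs1 hs).le hnn

lemma abs_inner_le_one {e : Space d} (he : ‖e‖ = 1) (y : Sph d) : |⟪e, (y : Space d)⟫| ≤ 1 := by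
  simpa [he, norm_eq_of_mem_sphere y] using abs_real_inner_le_norm e (y : Space d)

lemma one_sub_mul_inner_pos {u : ℝ} (hu : u ∈ Ioo (-1 : ℝ) 1) {e : Space d} (he : ‖e‖ = 1)
    (y : Sph d) : 0 < 1 - u * ⟪e, (y : Space d)⟫ := by
  have h1 := abs_lt.2 hu
  have h2 := abs_inner_le_one he y
  have h3 : u * ⟪e, (y : Space d)⟫ ≤ |u| * 1 :=
    (le_abs_self _).trans (by rw [abs_mul]; gcongr)
  linarith

/-- Both potentials are paired with the balayage densities for all centres `R • e`. Up to a
constant, `conf R e y` is `1 - u * ⟪e, y⟫` with `u = 2R / (1 + R²)`, and every `u` in `(-1, 1)`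
arises in this way. -/
lemma integral_inner_eq_of_potential (hd : 1 ≤ d) {s : ℝ} (hs0 : 0 < s) (hs1 : (d : ℝ) - 1 < s)
    (hs : s < d) {μ₁ μ₂ : Measure (Sph d)} [IsFiniteMeasure μ₁] [IsFiniteMeasure μ₂]
    (hmass : μ₁ univ = μ₂ univ) {G : ℝ}
    (hG : ∀ x : Sph d, (rieszPotential s μ₁ (x : Space d)).toReal -
      (rieszPotential s μ₂ (x : Space d)).toReal = G)
    {u : ℝ} (hu : u ∈ Ioo (-1 : ℝ) 1) {e : Space d} (he : ‖e‖ = 1) :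
    ∫ y : Sph d, (1 - u * ⟪e, (y : Space d)⟫) ^ (-(s / 2)) ∂μ₁ =
      ∫ y : Sph d, (1 - u * ⟪e, (y : Space d)⟫) ^ (-(s / 2)) ∂μ₂ := by
  have hW := W_pos hd hs0 hs1 hs
  have key : ∀ R ∈ Ioo (-1 : ℝ) 1, G * ∫ x : Sph d, conf R e x ^ (s / 2 - d) ∂(sigma d) =
      W d s * (∫ y : Sph d, conf R e y ^ (-(s / 2)) ∂μ₁ -
        ∫ y : Sph d, conf R e y ^ (-(s / 2)) ∂μ₂) := by
    intro R hR
    obtain ⟨i1, e1⟩ := integral_rieszPotential_mul_conf hd hs0 hs1 hs hR he μ₁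
    obtain ⟨i2, e2⟩ := integral_rieszPotential_mul_conf hd hs0 hs1 hs hR he μ₂
    rw [mul_sub, ← e1, ← e2, ← integral_sub i1 i2, ← integral_const_mul]
    refine integral_congr_ae (Filter.Eventually.of_forall fun x ↦ ?_)
    simp only [← hG x]
    ring
  -- At `R = 0` the pairing is with `sigma d` and sees only the masses, which agree.
  have hG0 : G = 0 := by
    have := key 0 (by norm_num)
    simpa [conf, measureReal_def, hmass] using this
  -- The root of `u R² - 2R + u = 0` in `(-1, 1)`, in a form that stays valid at `u = 0`.
  obtain ⟨R, hR, hRu⟩ : ∃ R ∈ Ioo (-1 : ℝ) 1, u * (1 + R ^ 2) = 2 * R := by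
    have hu2 := one_sub_sq_pos hu
    have hsq := Real.sq_sqrt hu2.le
    have hsp := Real.sqrt_pos.2 hu2
    have h1 : 0 < 1 + √(1 - u ^ 2) := by linarith
    refine ⟨u / (1 + √(1 - u ^ 2)), ⟨?_, ?_⟩, ?_⟩
    · rw [lt_div_iff₀ h1]; linarith [hu.1]
    · rw [div_lt_one h1]; linarith [hu.2]
    · field_simp
      linear_combination u * hsq
  have h2 := key R hR
  rw [hG0, zero_mul, zero_eq_mul, sub_eq_zero] at h2
  have h3 := h2.resolve_left hW.ne'
  have hc : 0 < (1 + R ^ 2) / (1 - R ^ 2) := hyperbola_pos hR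
  have h4 : ∀ y : Sph d, conf R e y ^ (-(s / 2)) = ((1 + R ^ 2) / (1 - R ^ 2)) ^ (-(s / 2)) *
      (1 - u * ⟪e, (y : Space d)⟫) ^ (-(s / 2)) := by
    intro y
    rw [← Real.mul_rpow hc.le (one_sub_mul_inner_pos hu he y).le, conf]
    congr 1
    rw [div_mul_eq_mul_div]
    congr 1
    linear_combination ⟪e, (y : Space d)⟫ * hRu
  simp only [h4, integral_const_mul] at h3
  exact mul_left_cancel₀ (Real.rpow_pos_of_pos hc _).ne' h3

/-- Differentiate `k` times in `u` and set `u = 0`. Each derivative brings out a factor `κ + k`,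
nonzero because `κ > 0`. -/
lemma integral_inner_pow_eq {κ : ℝ} (hκ : 0 < κ)
    {μ₁ μ₂ : Measure (Sph d)} [IsFiniteMeasure μ₁] [IsFiniteMeasure μ₂] {e : Space d}
    (he : ‖e‖ = 1)
    (h : ∀ u ∈ Ioo (-1 : ℝ) 1, ∫ y : Sph d, (1 - u * ⟪e, (y : Space d)⟫) ^ (-κ) ∂μ₁ =
      ∫ y : Sph d, (1 - u * ⟪e, (y : Space d)⟫) ^ (-κ) ∂μ₂) (k : ℕ) :
    ∫ y : Sph d, ⟪e, (y : Space d)⟫ ^ k ∂μ₁ = ∫ y : Sph d, ⟪e, (y : Space d)⟫ ^ k ∂μ₂ := by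
  have hderiv : ∀ (μ : Measure (Sph d)) (k : ℕ), IsFiniteMeasure μ → ∀ u ∈ Ioo (-1 : ℝ) 1,
      HasDerivAt (fun u ↦ ∫ y : Sph d,
        ⟪e, (y : Space d)⟫ ^ k * (1 - u * ⟪e, (y : Space d)⟫) ^ (-κ - k) ∂μ)
        ((κ + k) * ∫ y : Sph d,
          ⟪e, (y : Space d)⟫ ^ (k + 1) * (1 - u * ⟪e, (y : Space d)⟫) ^ (-κ - ↑(k + 1)) ∂μ) u := by
    intro μ k _ u hu
    rw [← integral_const_mul]
    refine hasDerivAt_integral_of_compact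
      (F' := fun u (y : Sph d) ↦ (κ + k) * (⟪e, (y : Space d)⟫ ^ (k + 1) *
        (1 - u * ⟪e, (y : Space d)⟫) ^ (-κ - ↑(k + 1)))) isOpen_Ioo hu ?_ ?_ ?_
    · intro u hu
      exact Continuous.mul (by fun_prop) (Continuous.rpow_const (by fun_prop)
        fun y ↦ Or.inl (one_sub_mul_inner_pos hu he y).ne')
    · refine ContinuousOn.mul (by fun_prop) (ContinuousOn.mul (by fun_prop)
        (ContinuousOn.rpow_const (by fun_prop) ?_))
      rintro ⟨u, y⟩ ⟨hu, -⟩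
      exact Or.inl (one_sub_mul_inner_pos hu he y).ne'
    · intro u hu y
      have h1 : HasDerivAt (fun u : ℝ ↦ (1 - u * ⟪e, (y : Space d)⟫) ^ (-κ - k)) _ u :=
        (((hasDerivAt_id' u).mul_const ⟪e, (y : Space d)⟫).const_sub 1).rpow_const
          (Or.inl (one_sub_mul_inner_pos hu he y).ne')
      refine (h1.const_mul _).congr_deriv ?_
      push_cast
      rw [← sub_sub]
      ring
  have key : ∀ k : ℕ, ∀ u ∈ Ioo (-1 : ℝ) 1,
      ∫ y : Sph d, ⟪e, (y : Space d)⟫ ^ k * (1 - u * ⟪e, (y : Space d)⟫) ^ (-κ - k) ∂μ₁ =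
      ∫ y : Sph d, ⟪e, (y : Space d)⟫ ^ k * (1 - u * ⟪e, (y : Space d)⟫) ^ (-κ - k) ∂μ₂ := by
    intro k
    induction k with
    | zero => simpa using h
    | succ k ih =>
      intro u hu
      have h1 := hderiv μ₁ k inferInstance u hu
      have h2 := hderiv μ₂ k inferInstance u hu
      have h3 := h1.unique (h2.congr_of_eventuallyEq (Filter.eventuallyEq_of_mem
        (isOpen_Ioo.mem_nhds hu) ih))
      exact mul_left_cancel₀ (by positivity) h3
  simpa using key k 0 (by norm_num)

lemma hasSum_integral_cexp_inner (μ : Measure (Sph d)) [IsFiniteMeasure μ] {e : Space d}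
    (he : ‖e‖ = 1) (τ : ℝ) :
    HasSum (fun k : ℕ ↦ ((τ * Complex.I) ^ k / k.factorial) *
        ((∫ y : Sph d, ⟪e, (y : Space d)⟫ ^ k ∂μ : ℝ) : ℂ))
      (∫ y : Sph d, Complex.exp (τ * Complex.I * (⟪e, (y : Space d)⟫ : ℝ)) ∂μ) := by
  have hint : ∀ k : ℕ, Integrable (fun y : Sph d ↦ ((τ * Complex.I) ^ k / k.factorial) *
      ((⟪e, (y : Space d)⟫ ^ k : ℝ) : ℂ)) μ := fun k ↦
    ((integrable_of_continuous (g := fun y : Sph d ↦ ⟪e, (y : Space d)⟫ ^ k)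
      (by fun_prop)).ofReal).const_mul _
  have h1 : ∀ k : ℕ, ∫ y : Sph d, ((τ * Complex.I) ^ k / k.factorial) *
      ((⟪e, (y : Space d)⟫ ^ k : ℝ) : ℂ) ∂μ = ((τ * Complex.I) ^ k / k.factorial) *
        ((∫ y : Sph d, ⟪e, (y : Space d)⟫ ^ k ∂μ : ℝ) : ℂ) := fun k ↦ by
    rw [integral_const_mul, integral_complex_ofReal]
  have h2 : ∀ y : Sph d, ∑' k : ℕ, ((τ * Complex.I) ^ k / k.factorial) *
      ((⟪e, (y : Space d)⟫ ^ k : ℝ) : ℂ) =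
      Complex.exp (τ * Complex.I * (⟪e, (y : Space d)⟫ : ℝ)) := fun y ↦ by
    rw [Complex.exp_eq_exp_ℂ, NormedSpace.exp_eq_tsum_div]
    refine tsum_congr fun k ↦ ?_
    push_cast
    rw [mul_pow _ ((⟪e, (y : Space d)⟫ : ℝ) : ℂ)]
    ring
  have h := hasSum_integral_of_summable_integral_norm hint ?_
  · simp only [h1, h2] at h
    exact h
  · refine Summable.of_nonneg_of_le (fun k ↦ integral_nonneg fun y ↦ norm_nonneg _)
      (fun k ↦ ?_) ((Real.summable_pow_div_factorial |τ|).mul_right (μ.real univ))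
    refine (integral_mono (hint k).norm (integrable_const (|τ| ^ k / k.factorial)) fun y ↦ ?_).trans
      (by simp [mul_comm])
    have h3 : |⟪e, (y : Space d)⟫| ^ k ≤ 1 := pow_le_one₀ (abs_nonneg _) (abs_inner_le_one he y)
    simp only [norm_mul, norm_div, norm_pow, Complex.norm_real, Real.norm_eq_abs, Complex.norm_I,
      mul_one, Complex.norm_natCast]
    exact mul_le_of_le_one_right (by positivity) h3

/-- On the bounded set `Sph d` the characteristic function at `ξ = ‖ξ‖ • e` is the power series
whose coefficients are the moments of `⟪e, y⟫`, so these determine the measure. -/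
lemma measure_eq_of_moments {μ₁ μ₂ : Measure (Sph d)} [IsFiniteMeasure μ₁] [IsFiniteMeasure μ₂]
    (h : ∀ e : Space d, ‖e‖ = 1 → ∀ k : ℕ, ∫ y : Sph d, ⟪e, (y : Space d)⟫ ^ k ∂μ₁ =
      ∫ y : Sph d, ⟪e, (y : Space d)⟫ ^ k ∂μ₂) : μ₁ = μ₂ := by
  have hemb : MeasurableEmbedding (Subtype.val : Sph d → Space d) :=
    MeasurableEmbedding.subtype_coe Metric.isClosed_sphere.measurableSet
  have hmap : μ₁.map (Subtype.val : Sph d → Space d) = μ₂.map Subtype.val := by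
    refine Measure.ext_of_charFun (funext fun ξ ↦ ?_)
    obtain ⟨e, he, hξ⟩ : ∃ e : Space d, ‖e‖ = 1 ∧ ξ = ‖ξ‖ • e := by
      rcases eq_or_ne ξ 0 with rfl | hne
      · exact ⟨axis d, norm_axis, by simp⟩
      · exact ⟨‖ξ‖⁻¹ • ξ, by simp [norm_smul, hne], by simp [smul_smul, hne]⟩
    have h1 : ∀ y : Space d, Complex.exp (⟪y, ξ⟫ * Complex.I) =
        Complex.exp (‖ξ‖ * Complex.I * (⟪e, y⟫ : ℝ)) := by
      intro y
      conv_lhs => rw [hξ, inner_smul_right, real_inner_comm]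
      push_cast
      ring_nf
    rw [charFun_apply, charFun_apply, hemb.integral_map, hemb.integral_map]
    simp only [h1]
    refine (hasSum_integral_cexp_inner μ₁ he ‖ξ‖).unique ?_
    simp only [h e he]
    exact hasSum_integral_cexp_inner μ₂ he ‖ξ‖
  rw [← hemb.comap_map μ₁, hmap, hemb.comap_map]

/-- Unicity of finite measures of given mass whose potentials differ by a constant. -/
lemma measure_eq_of_potential (hd : 1 ≤ d) {s : ℝ} (hs0 : 0 < s) (hs1 : (d : ℝ) - 1 < s)
    (hs : s < d) {μ₁ μ₂ : Measure (Sph d)} [IsFiniteMeasure μ₁] [IsFiniteMeasure μ₂]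
    (hmass : μ₁ univ = μ₂ univ) {G : ℝ}
    (hG : ∀ x : Sph d, (rieszPotential s μ₁ (x : Space d)).toReal -
      (rieszPotential s μ₂ (x : Space d)).toReal = G) : μ₁ = μ₂ :=
  measure_eq_of_moments fun _ he ↦ integral_inner_pow_eq (half_pos hs0) he fun _ hu ↦
    integral_inner_eq_of_potential hd hs0 hs1 hs hmass hG hu he

/-- Minimality of the Jordan decomposition: on the set carrying the positive part, `η` coincides
with it and is at most `μ₁`. This allows potentials, defined through the Jordan decomposition, to be
computed from any decomposition at hand. -/
lemma posPart_le_of_eq_sub {α : Type*} [MeasurableSpace α] {η : SignedMeasure α}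
    {μ₁ μ₂ : Measure α} [IsFiniteMeasure μ₁] [IsFiniteMeasure μ₂]
    (h : ∀ A, MeasurableSet A → η A = μ₁.real A - μ₂.real A) :
    η.toJordanDecomposition.posPart ≤ μ₁ := by
  obtain ⟨P, hP, hP1, hP2⟩ := η.toJordanDecomposition.mutuallySingular
  refine Measure.le_iff.2 fun A hA ↦ ?_
  have h1 : η.toJordanDecomposition.posPart A = η.toJordanDecomposition.posPart (A ∩ Pᶜ) := by
    refine le_antisymm ?_ (measure_mono inter_subset_left)
    rw [← measure_inter_add_sdiff A hP, sdiff_eq]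
    exact (add_le_add_left (measure_mono_null inter_subset_right hP1).le _).trans (by simp)
  have h2 : η.toJordanDecomposition.negPart (A ∩ Pᶜ) = 0 := measure_mono_null inter_subset_right hP2
  have h3 := η.apply_eq_posPart_real_sub_negPart_real (hA.inter hP.compl)
  rw [h _ (hA.inter hP.compl), measureReal_def (μ := η.toJordanDecomposition.negPart), h2,
    ENNReal.toReal_zero, sub_zero] at h3
  have h4 : η.toJordanDecomposition.posPart.real (A ∩ Pᶜ) ≤ μ₁.real (A ∩ Pᶜ) := by
    rw [← h3]; linarith [measureReal_nonneg (μ := μ₂) (s := A ∩ Pᶜ)]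
  rw [h1]
  refine le_trans ?_ (measure_mono (inter_subset_left (t := Pᶜ)))
  exact (ENNReal.toReal_le_toReal (measure_ne_top _ _) (measure_ne_top _ _)).1 h4

lemma negPart_le_of_eq_sub {α : Type*} [MeasurableSpace α] {η : SignedMeasure α}
    {μ₁ μ₂ : Measure α} [IsFiniteMeasure μ₁] [IsFiniteMeasure μ₂]
    (h : ∀ A, MeasurableSet A → η A = μ₁.real A - μ₂.real A) :
    η.toJordanDecomposition.negPart ≤ μ₂ := by
  have h1 := posPart_le_of_eq_sub (η := -η) (μ₁ := μ₂) (μ₂ := μ₁) fun A hA ↦ by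
    rw [neg_apply, h A hA, neg_sub]
  rwa [SignedMeasure.toJordanDecomposition_neg, JordanDecomposition.neg_posPart] at h1

lemma posPart_add_eq_of_eq_sub {α : Type*} [MeasurableSpace α] {η : SignedMeasure α}
    {μ₁ μ₂ : Measure α} [IsFiniteMeasure μ₁] [IsFiniteMeasure μ₂]
    (h : ∀ A, MeasurableSet A → η A = μ₁.real A - μ₂.real A) :
    η.toJordanDecomposition.posPart + μ₂ = μ₁ + η.toJordanDecomposition.negPart := by
  ext A hA
  have h1 := η.apply_eq_posPart_real_sub_negPart_real hA
  rw [h A hA] at h1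
  rw [← ENNReal.toReal_eq_toReal_iff' (measure_ne_top _ _) (measure_ne_top _ _),
    Measure.add_apply, Measure.add_apply, ENNReal.toReal_add (measure_ne_top _ _) (measure_ne_top _ _),
    ENNReal.toReal_add (measure_ne_top _ _) (measure_ne_top _ _)]
  simp only [measureReal_def] at h1
  linarith

lemma rieszPotential_add (s : ℝ) (μ ν : Measure (Sph d)) (x : Space d) :
    rieszPotential s (μ + ν) x = rieszPotential s μ x + rieszPotential s ν x :=
  lintegral_add_measure _ _ _

lemma rieszPotential_mono (s : ℝ) {μ ν : Measure (Sph d)} (h : μ ≤ ν) (x : Space d) :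
    rieszPotential s μ x ≤ rieszPotential s ν x :=
  lintegral_mono' h le_rfl

lemma rieszPotential_totalVariation_lt_top {s : ℝ} {η : SignedMeasure (Sph d)}
    {μ₁ μ₂ : Measure (Sph d)} [IsFiniteMeasure μ₁] [IsFiniteMeasure μ₂]
    (h : ∀ A, MeasurableSet A → η A = μ₁.real A - μ₂.real A) {x : Space d}
    (h1 : rieszPotential s μ₁ x < ⊤) (h2 : rieszPotential s μ₂ x < ⊤) :
    rieszPotential s η.totalVariation x < ⊤ := by
  rw [SignedMeasure.totalVariation, rieszPotential_add]
  exact ENNReal.add_lt_top.2 ⟨(rieszPotential_mono s (posPart_le_of_eq_sub h) x).trans_lt h1,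
    (rieszPotential_mono s (negPart_le_of_eq_sub h) x).trans_lt h2⟩

lemma signedPotential_eq_of_eq_sub {s : ℝ} {η : SignedMeasure (Sph d)}
    {μ₁ μ₂ : Measure (Sph d)} [IsFiniteMeasure μ₁] [IsFiniteMeasure μ₂]
    (h : ∀ A, MeasurableSet A → η A = μ₁.real A - μ₂.real A) {x : Space d}
    (h1 : rieszPotential s μ₁ x < ⊤) (h2 : rieszPotential s μ₂ x < ⊤) :
    signedPotential s η x = (rieszPotential s μ₁ x).toReal - (rieszPotential s μ₂ x).toReal := by
  have h3 := (rieszPotential_mono s (posPart_le_of_eq_sub h) x).trans_lt h1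
  have h4 := (rieszPotential_mono s (negPart_le_of_eq_sub h) x).trans_lt h2
  have h5 := congrArg (fun ν ↦ (rieszPotential s ν x).toReal) (posPart_add_eq_of_eq_sub h)
  simp only [rieszPotential_add] at h5
  rw [ENNReal.toReal_add h3.ne h2.ne, ENNReal.toReal_add h1.ne h4.ne] at h5
  rw [signedPotential]
  linarith

/-- Unicity of the signed equilibrium. -/
lemma IsSignedEquilibrium.unique (hd : 1 ≤ d) {s : ℝ} (hs0 : 0 < s) (hs1 : (d : ℝ) - 1 < s)
    (hs : s < d) {Q : Sph d → ℝ} {η₁ η₂ : SignedMeasure (Sph d)}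
    (h₁ : IsSignedEquilibrium s Q η₁) (h₂ : IsSignedEquilibrium s Q η₂) : η₁ = η₂ := by
  have hf₁ := h₁.finite
  have hf₂ := h₂.finite
  simp only [SignedMeasure.totalVariation, rieszPotential_add, ENNReal.add_lt_top] at hf₁ hf₂
  obtain ⟨G₁, hG₁⟩ := h₁.const
  obtain ⟨G₂, hG₂⟩ := h₂.const
  have hη₁ := fun A (hA : MeasurableSet A) ↦ η₁.apply_eq_posPart_real_sub_negPart_real hA
  have hη₂ := fun A (hA : MeasurableSet A) ↦ η₂.apply_eq_posPart_real_sub_negPart_real hA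
  -- Moving the negative parts across leaves two positive measures of equal mass, as
  -- `measure_eq_of_potential` requires.
  have key : η₁.toJordanDecomposition.posPart + η₂.toJordanDecomposition.negPart =
      η₂.toJordanDecomposition.posPart + η₁.toJordanDecomposition.negPart := by
    refine measure_eq_of_potential hd hs0 hs1 hs ?_ (G := G₁ - G₂) fun x ↦ ?_
    · have e1 := hη₁ univ MeasurableSet.univ
      have e2 := hη₂ univ MeasurableSet.univ
      rw [h₁.total] at e1
      rw [h₂.total] at e2
      rw [← ENNReal.toReal_eq_toReal_iff' (measure_ne_top _ _) (measure_ne_top _ _),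
        Measure.add_apply, Measure.add_apply,
        ENNReal.toReal_add (measure_ne_top _ _) (measure_ne_top _ _),
        ENNReal.toReal_add (measure_ne_top _ _) (measure_ne_top _ _)]
      simp only [measureReal_def] at e1 e2
      linarith
    · rw [rieszPotential_add, rieszPotential_add, ENNReal.toReal_add (hf₁ x).1.ne (hf₂ x).2.ne,
        ENNReal.toReal_add (hf₂ x).1.ne (hf₁ x).2.ne]
      have e1 := hG₁ x
      have e2 := hG₂ x
      rw [signedPotential] at e1 e2
      linarith
  refine VectorMeasure.ext fun A hA ↦ ?_
  have e := congrArg (fun ν ↦ (ν A).toReal) key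
  simp only [Measure.add_apply] at e
  rw [ENNReal.toReal_add (measure_ne_top _ _) (measure_ne_top _ _),
    ENNReal.toReal_add (measure_ne_top _ _) (measure_ne_top _ _)] at e
  rw [hη₁ A hA, hη₂ A hA]
  simp only [measureReal_def]
  linarith

/-! ### The explicit signed equilibrium -/

lemma rieszPotential_withDensity_eq (hd : 1 ≤ d) (s : ℝ) {h : Sph d → ℝ} (hh : Continuous h)
    (x : Sph d) : rieszPotential s ((sigma d).withDensity fun y ↦ ENNReal.ofReal (h y)) x =
      ∫⁻ y : Sph d, ENNReal.ofReal (dist (x : Space d) y ^ (-s) * h y) ∂(sigma d) := by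
  have hkx : Measurable fun y : Sph d ↦ edist (x : Space d) (y : Space d) ^ (-s) :=
    (measurable_kernel s (x : Space d)).comp measurable_subtype_coe
  rw [rieszPotential, lintegral_withDensity_eq_lintegral_mul _ hh.measurable.ennreal_ofReal hkx]
  refine lintegral_congr_ae ?_
  filter_upwards [ae_ne_sigma hd x] with y hy
  rw [Pi.mul_apply, edist_rpow_neg hy, mul_comm, ← ENNReal.ofReal_mul (by positivity)]

lemma integrable_kernel_mul (hd : 1 ≤ d) {s : ℝ} (hs0 : 0 < s) (hs : s < d) {h : Sph d → ℝ}
    (hh : Continuous h) (x : Sph d) :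
    Integrable (fun y : Sph d ↦ dist (x : Space d) y ^ (-s) * h y) (sigma d) := by
  obtain ⟨C, hC⟩ := isCompact_univ.exists_bound_of_continuousOn hh.continuousOn
  exact (integrable_kernel_sigma hd hs0 hs x).mul_bdd hh.aestronglyMeasurable
    (Filter.Eventually.of_forall fun y ↦ hC y (mem_univ y))

lemma withDensityᵥ_eq_sub {α : Type*} [MeasurableSpace α] {μ : Measure α} {h : α → ℝ}
    (hi : Integrable h μ) (A : Set α) (hA : MeasurableSet A) : μ.withDensityᵥ h A =
      (μ.withDensity fun y ↦ ENNReal.ofReal (h y)).real A -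
        (μ.withDensity fun y ↦ ENNReal.ofReal (-h y)).real A := by
  rw [withDensityᵥ_apply hi hA, integral_eq_lintegral_pos_part_sub_lintegral_neg_part hi.integrableOn,
    measureReal_def, measureReal_def, withDensity_apply _ hA, withDensity_apply _ hA]

lemma potential_withDensityᵥ (hd : 1 ≤ d) {s : ℝ} (hs0 : 0 < s) (hs : s < d) {h : Sph d → ℝ}
    (hh : Continuous h) (x : Sph d) :
    rieszPotential s (SignedMeasure.totalVariation ((sigma d).withDensityᵥ h)) (x : Space d) < ⊤ ∧
    signedPotential s ((sigma d).withDensityᵥ h) (x : Space d) =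
      ∫ y : Sph d, dist (x : Space d) y ^ (-s) * h y ∂(sigma d) := by
  have hi : Integrable h (sigma d) := integrable_of_continuous hh
  have i1 := isFiniteMeasure_withDensity_ofReal hi.2
  have i2 := isFiniteMeasure_withDensity_ofReal hi.neg.2
  simp only [Pi.neg_apply] at i2
  have hk := integrable_kernel_mul hd hs0 hs hh x
  have hk' := integrable_kernel_mul hd hs0 hs hh.neg x
  have hneg := rieszPotential_withDensity_eq hd s hh.neg x
  simp only [Pi.neg_apply] at hneg
  have f1 : rieszPotential s ((sigma d).withDensity fun y ↦ ENNReal.ofReal (h y)) x < ⊤ := by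
    rw [rieszPotential_withDensity_eq hd s hh]
    exact hk.lintegral_lt_top
  have f2 : rieszPotential s ((sigma d).withDensity fun y ↦ ENNReal.ofReal (-h y)) x < ⊤ := by
    rw [hneg]
    exact hk'.lintegral_lt_top
  refine ⟨rieszPotential_totalVariation_lt_top (withDensityᵥ_eq_sub hi) f1 f2, ?_⟩
  rw [signedPotential_eq_of_eq_sub (withDensityᵥ_eq_sub hi) f1 f2,
    integral_eq_lintegral_pos_part_sub_lintegral_neg_part hk,
    rieszPotential_withDensity_eq hd s hh, hneg]
  simp only [mul_neg]

/-- The density of the signed equilibrium for the charge `q` at height `R` on the polar axis. -/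
noncomputable def eqDensity (d : ℕ) (s q R : ℝ) (y : Sph d) : ℝ :=
  1 + q * U d s R / W d s -
    q / W d s * (1 - R ^ 2) ^ (-(s / 2)) * conf R (axis d) y ^ (s / 2 - d)

lemma continuous_eqDensity {s q R : ℝ} (hR : R ∈ Ioo (-1 : ℝ) 1) :
    Continuous (eqDensity d s q R) :=
  continuous_const.sub ((continuous_conf_rpow hR norm_axis _).const_mul _)

lemma integral_kernel_conf (hd : 1 ≤ d) {s R : ℝ} (hs0 : 0 < s) (hs1 : (d : ℝ) - 1 < s)
    (hs : s < d) (hR : R ∈ Ioo (-1 : ℝ) 1) {e : Space d} (he : ‖e‖ = 1) (x : Sph d) :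
    ∫ y : Sph d, dist (x : Space d) y ^ (-s) * conf R e y ^ (s / 2 - d) ∂(sigma d) =
      W d s * conf R e x ^ (-(s / 2)) := by
  have hpos : ∀ y : Sph d, 0 < conf R e y := fun y ↦ conf_pos hR he (norm_eq_of_mem_sphere y)
  have hc := continuous_conf_rpow hR he (s / 2 - d)
  rw [integral_eq_lintegral_of_nonneg_ae (Filter.Eventually.of_forall fun y ↦
      mul_nonneg (by positivity) (Real.rpow_nonneg (hpos y).le _))
    (integrable_kernel_mul hd hs0 hs hc x).aestronglyMeasurable]
  have h1 := lintegral_kernel_conf (s := s) hR he (norm_eq_of_mem_sphere x)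
  rw [rieszPotential_sigma_axis hd hs0 hs, ← ENNReal.ofReal_mul (W_pos hd hs0 hs1 hs).le] at h1
  rw [← ENNReal.toReal_ofReal (mul_nonneg (W_pos hd hs0 hs1 hs).le
    (Real.rpow_nonneg (hpos x).le (-(s / 2)))), ← h1]
  congr 1
  refine lintegral_congr_ae ?_
  filter_upwards [ae_ne_sigma hd x] with y hy
  rw [edist_rpow_neg hy, ENNReal.ofReal_mul (by positivity)]

lemma integral_kernel (hd : 1 ≤ d) {s : ℝ} (hs0 : 0 < s) (hs1 : (d : ℝ) - 1 < s)
    (hs : s < d) (x : Sph d) :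
    ∫ y : Sph d, dist (x : Space d) y ^ (-s) ∂(sigma d) = W d s := by
  simpa [conf] using integral_kernel_conf hd hs0 hs1 hs (R := 0) (by norm_num) norm_axis x

/-- The `conf` term is `-q` times the balayage of a unit charge at `R • axis d`, so its potential
cancels the field on the sphere. The mass of that balayage is `U d s R / W d s` by `confInt_symm`,
which explains the coefficient of `sigma d`. The remaining constant is `W d s + q * U d s R`. -/
lemma isSignedEquilibrium_eqDensity (hd : 1 ≤ d) {s q R : ℝ} (hs0 : 0 < s)
    (hs1 : (d : ℝ) - 1 < s) (hs : s < d) (hR : R ∈ Ico (0 : ℝ) 1) :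
    IsSignedEquilibrium s (field d s q R) ((sigma d).withDensityᵥ (eqDensity d s q R)) := by
  have hR' : R ∈ Ioo (-1 : ℝ) 1 := ⟨by linarith [hR.1], hR.2⟩
  have hW := W_pos hd hs0 hs1 hs
  have hcont : Continuous (eqDensity d s q R) := continuous_eqDensity hR'
  have hc := continuous_conf_rpow (d := d) hR' norm_axis (s / 2 - d)
  refine ⟨?_, fun x ↦ (potential_withDensityᵥ hd hs0 hs hcont x).1, W d s + q * U d s R, fun x ↦ ?_⟩
  · rw [withDensityᵥ_apply (integrable_of_continuous hcont) MeasurableSet.univ, setIntegral_univ]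
    simp only [eqDensity]
    rw [integral_sub (integrable_const _) (integrable_of_continuous (hc.const_mul _)),
      integral_const_mul, integral_const, probReal_univ, one_smul, U_eq_confInt hd hR,
      confInt_symm hR' norm_axis, confInt]
    simp only [neg_sub]
    ring
  · rw [(potential_withDensityᵥ hd hs0 hs hcont x).2]
    have h1 : ∀ y : Sph d, dist (x : Space d) y ^ (-s) * eqDensity d s q R y =
        (1 + q * U d s R / W d s) * dist (x : Space d) y ^ (-s) -
        q / W d s * (1 - R ^ 2) ^ (-(s / 2)) *
          (dist (x : Space d) y ^ (-s) * conf R (axis d) y ^ (s / 2 - d)) := fun y ↦ by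
      rw [eqDensity]; ring
    simp only [h1]
    rw [integral_sub ((integrable_kernel_sigma hd hs0 hs x).const_mul _)
      ((integrable_kernel_mul hd hs0 hs hc x).const_mul _), integral_const_mul, integral_const_mul,
      integral_kernel hd hs0 hs1 hs, integral_kernel_conf hd hs0 hs1 hs hR' norm_axis, field]
    have hx := norm_eq_of_mem_sphere x
    have h2 : q / dist (x : Space d) (R • axis d) ^ s =
        q * ((1 - R ^ 2) ^ (-(s / 2)) * conf R (axis d) x ^ (-(s / 2))) := by
      rw [div_eq_mul_inv, ← Real.rpow_neg dist_nonneg, dist_comm, dist_rpow_eq norm_axis hx,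
        quad_rpow hR' norm_axis hx]
    rw [h2]
    field_simp
    ring

lemma eqDensity_southPole {s q R : ℝ} (hR : R ∈ Ico (0 : ℝ) 1) :
    eqDensity d s q R (southPole d) = 1 - q / W d s * f d s R := by
  have h1 : 0 < 1 - R := sub_pos.2 hR.2
  have h2 : 0 < 1 + R := by linarith [hR.1]
  have hc : conf R (axis d) (southPole d) = (1 + R) / (1 - R) := by
    have h3 : (1 : ℝ) - R ^ 2 ≠ 0 := by nlinarith
    rw [conf, southPole, inner_neg_right, real_inner_self_eq_norm_sq, norm_axis]
    field_simp
    ring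
  have h4 : (1 - R ^ 2) ^ (-(s / 2)) * ((1 + R) / (1 - R)) ^ (s / 2 - d) =
      (1 - R) ^ ((d : ℝ) - s) / (1 + R) ^ d := by
    rw [show 1 - R ^ 2 = (1 - R) * (1 + R) by ring, Real.mul_rpow h1.le h2.le,
      Real.div_rpow h2.le h1.le, Real.rpow_neg h1.le, Real.rpow_neg h2.le, Real.rpow_sub h2,
      Real.rpow_sub h1, Real.rpow_sub h1, Real.rpow_natCast, Real.rpow_natCast]
    have e1 : (1 - R) ^ s = (1 - R) ^ (s / 2) * (1 - R) ^ (s / 2) := by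
      rw [← Real.rpow_add h1, add_halves]
    rw [e1]
    have := Real.rpow_pos_of_pos h1 (s / 2)
    have := Real.rpow_pos_of_pos h2 (s / 2)
    field_simp
  rw [eqDensity, hc, mul_assoc, h4, f, abs_sub_comm, abs_of_pos h1, add_comm R 1]
  ring

/-- For `R > 0` the South Pole is the unique farthest point from the charge, so `conf` is largest
there. Its exponent is negative and its coefficient in the density positive. -/
lemma eqDensity_southPole_lt (hd : 1 ≤ d) {s q R : ℝ} (hs0 : 0 < s) (hs1 : (d : ℝ) - 1 < s)
    (hs : s < d) (hq : q < 0) (hR : R ∈ Ioo (0 : ℝ) 1) {y : Sph d} (hy : y ≠ southPole d) :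
    eqDensity d s q R (southPole d) < eqDensity d s q R y := by
  have hR' : R ∈ Ioo (-1 : ℝ) 1 := ⟨by linarith [hR.1], hR.2⟩
  have hR0 := hR.1
  have hc := one_sub_sq_pos hR'
  have hyn := norm_eq_of_mem_sphere y
  have h1 : -1 < ⟪axis d, (y : Space d)⟫ := by
    refine lt_of_le_of_ne (abs_le.1 (abs_inner_le_one norm_axis y)).1 fun h ↦ hy (Subtype.ext ?_)
    have h2 : ⟪-axis d, (y : Space d)⟫ = 1 := by rw [inner_neg_left, ← h, neg_neg]
    exact ((inner_eq_one_iff_of_norm_eq_one (by rw [norm_neg, norm_axis]) hyn).1 h2).symm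
  have h2 : conf R (axis d) y < conf R (axis d) (southPole d) := by
    rw [conf, conf, southPole, inner_neg_right, real_inner_self_eq_norm_sq, norm_axis]
    gcongr
    linarith
  have h3 := Real.rpow_lt_rpow_of_neg (conf_pos hR' norm_axis hyn) h2
    (show s / 2 - d < 0 by linarith)
  have h4 : q / W d s * (1 - R ^ 2) ^ (-(s / 2)) < 0 :=
    mul_neg_of_neg_of_pos (div_neg_of_neg_of_pos hq (W_pos hd hs0 hs1 hs))
      (Real.rpow_pos_of_pos hc _)
  rw [eqDensity, eqDensity]
  linarith [mul_lt_mul_of_neg_left h3 h4]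

lemma eqDensity_zero (hd : 1 ≤ d) (s q : ℝ) (y : Sph d) : eqDensity d s q 0 y = 1 := by
  simp [eqDensity, conf, U_zero hd]

/-! ### Sign, support and vanishing of the density -/

lemma withDensityᵥ_nonneg {h : Sph d → ℝ} (hh : Continuous h) (h0 : ∀ y, 0 ≤ h y) :
    0 ≤ (sigma d).withDensityᵥ h := by
  refine VectorMeasure.le_iff.2 fun A hA ↦ ?_
  rw [withDensityᵥ_apply (integrable_of_continuous hh) hA]
  exact integral_nonneg h0

lemma nonneg_of_withDensityᵥ_nonneg {h : Sph d → ℝ} (hh : Continuous h)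
    (h0 : 0 ≤ (sigma d).withDensityᵥ h) (x : Sph d) : 0 ≤ h x := by
  by_contra! hx
  have hV : IsOpen {y | h y < 0} := isOpen_lt hh continuous_const
  have h1 := VectorMeasure.le_iff.1 h0 _ hV.measurableSet
  rw [withDensityᵥ_apply (integrable_of_continuous hh) hV.measurableSet] at h1
  have h2 : 0 < ∫ y in {y | h y < 0}, -h y ∂(sigma d) := by
    rw [setIntegral_pos_iff_support_of_nonneg_ae]
    · refine (hV.measure_pos (sigma d) ⟨x, hx⟩).trans_le (measure_mono fun y hy ↦ ⟨?_, hy⟩)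
      exact (neg_pos.2 hy).ne'
    · filter_upwards [self_mem_ae_restrict hV.measurableSet] with y hy
      exact (neg_pos.2 hy).le
    · exact (integrable_of_continuous hh.neg).integrableOn
  rw [integral_neg] at h2
  have h3 : (0 : ℝ) ≤ ∫ y in {y | h y < 0}, h y ∂(sigma d) := h1
  linarith

/-- A single zero is allowed because points are `sigma d`-null. This covers the critical position,
where the density vanishes at the South Pole only. -/
lemma hasFullSupport_withDensityᵥ (hd : 1 ≤ d) {h : Sph d → ℝ} (hh : Continuous h) {x : Sph d}
    (h0 : 0 ≤ h x) (hpos : ∀ y, y ≠ x → 0 < h y) : HasFullSupport ((sigma d).withDensityᵥ h) := by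
  intro V hV hne
  rw [withDensityᵥ_apply (integrable_of_continuous hh) hV.measurableSet,
    setIntegral_pos_iff_support_of_nonneg_ae]
  · refine (hV.measure_pos (sigma d) hne).trans_le ?_
    rw [← measure_sdiff_null (sigma_singleton hd x)]
    exact measure_mono fun y hy ↦ ⟨(hpos y hy.2).ne', hy.1⟩
  · refine Filter.Eventually.of_forall fun y ↦ ?_
    rcases eq_or_ne y x with rfl | hy
    · exact h0
    · exact (hpos y hy).le
  · exact (integrable_of_continuous hh).integrableOn

lemma IsSignedEquilibrium.eq_withDensityᵥ (hd : 1 ≤ d) {s q R : ℝ} (hs0 : 0 < s)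
    (hs1 : (d : ℝ) - 1 < s) (hs : s < d) (hR : R ∈ Ico (0 : ℝ) 1) {η : SignedMeasure (Sph d)}
    (hη : IsSignedEquilibrium s (field d s q R) η) :
    η = (sigma d).withDensityᵥ (eqDensity d s q R) :=
  hη.unique hd hs0 hs1 hs (isSignedEquilibrium_eqDensity hd hs0 hs1 hs hR)

lemma IsSignedEquilibrium.nonneg_iff (hd : 1 ≤ d) {s q R : ℝ} (hs0 : 0 < s)
    (hs1 : (d : ℝ) - 1 < s) (hs : s < d) (hq : q < 0) (hR : R ∈ Ioo (0 : ℝ) 1)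
    {η : SignedMeasure (Sph d)} (hη : IsSignedEquilibrium s (field d s q R) η) :
    (0 ≤ η ↔ W d s / q ≤ f d s R) ∧ (W d s / q ≤ f d s R → HasFullSupport η) := by
  have hR' : R ∈ Ico (0 : ℝ) 1 := ⟨hR.1.le, hR.2⟩
  have hcont : Continuous (eqDensity d s q R) := continuous_eqDensity ⟨by linarith [hR.1], hR.2⟩
  have hW := W_pos hd hs0 hs1 hs
  have hiff : 0 ≤ eqDensity d s q R (southPole d) ↔ W d s / q ≤ f d s R := by
    rw [eqDensity_southPole hR', sub_nonneg, div_mul_eq_mul_div, div_le_one hW,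
      div_le_iff_of_neg hq, mul_comm]
  have hlt := fun y (hy : y ≠ southPole d) ↦ eqDensity_southPole_lt hd hs0 hs1 hs hq hR hy
  rw [hη.eq_withDensityᵥ hd hs0 hs1 hs hR', ← hiff]
  refine ⟨⟨fun h ↦ nonneg_of_withDensityᵥ_nonneg hcont h _, fun h ↦ withDensityᵥ_nonneg hcont
    fun y ↦ ?_⟩, fun h ↦ hasFullSupport_withDensityᵥ hd hcont h fun y hy ↦ h.trans_lt (hlt y hy)⟩
  rcases eq_or_ne y (southPole d) with rfl | hy
  · exact h
  · exact h.trans (hlt y hy).le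

/-- By uniqueness of the equilibrium any continuous density agrees almost everywhere with
`eqDensity`, hence everywhere, since `sigma d` charges every nonempty open set. -/
lemma densityVanishesAtSouthPole_iff (hd : 1 ≤ d) {s q R : ℝ} (hs0 : 0 < s)
    (hs1 : (d : ℝ) - 1 < s) (hs : s < d) (hR : R ∈ Ico (0 : ℝ) 1) :
    DensityVanishesAtSouthPole d s q R ↔ eqDensity d s q R (southPole d) = 0 := by
  have hcont : Continuous (eqDensity d s q R) := continuous_eqDensity ⟨by linarith [hR.1], hR.2⟩
  refine ⟨?_, fun h ↦ ⟨_, hcont, isSignedEquilibrium_eqDensity hd hs0 hs1 hs hR, h⟩⟩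
  rintro ⟨h, hh, heq, h0⟩
  have h1 := (integrable_of_continuous hh).ae_eq_of_withDensityᵥ_eq (integrable_of_continuous hcont)
    (heq.eq_withDensityᵥ hd hs0 hs1 hs hR)
  rw [← (hh.ae_eq_iff_eq (sigma d) hcont).1 h1, h0]

lemma densityVanishesAtSouthPole_iff_f (hd : 1 ≤ d) {s q R : ℝ} (hs0 : 0 < s)
    (hs1 : (d : ℝ) - 1 < s) (hs : s < d) (hq : q < 0) (hR : R ∈ Ico (0 : ℝ) 1) :
    DensityVanishesAtSouthPole d s q R ↔ W d s / q = f d s R := by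
  have hW := W_pos hd hs0 hs1 hs
  rw [densityVanishesAtSouthPole_iff hd hs0 hs1 hs hR, eqDensity_southPole hR, sub_eq_zero,
    div_mul_eq_mul_div, eq_div_iff hW.ne', one_mul, div_eq_iff hq.ne, mul_comm q]

lemma goncharD_eq_zero_iff {s q R : ℝ} (hR : R ∈ Ioo (0 : ℝ) 1) :
    goncharD d s q R = 0 ↔ W d s / q = f d s R := by
  have h1 : 0 < 1 + R := by linarith [hR.1]
  -- The Gonchar function is the characteristic equation cleared of its denominator `(1 + R) ^ d`.
  have h2 : goncharD d s q R = (1 + R) ^ d * (W d s / q - f d s R) := by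
    rw [goncharD, f, abs_sub_comm, abs_of_pos (sub_pos.2 hR.2), add_comm R 1]
    field_simp
    ring
  rw [h2, mul_eq_zero, sub_eq_zero, or_iff_right (by positivity)]

lemma dist_smul_axis_axis {R : ℝ} (hR : R ≤ 1) : dist (R • axis d) (axis d) = 1 - R := by
  have h : R • axis d - axis d = (R - 1) • axis d := by rw [sub_smul, one_smul]
  rw [dist_eq_norm, h, norm_smul, norm_axis, mul_one, Real.norm_eq_abs, abs_sub_comm,
    abs_of_nonneg (sub_nonneg.2 hR)]

end RieszSphere

theorem mainTheorem8 (d : ℕ) (hd : 1 ≤ d) (s : ℝ) (hs : (d : ℝ) - 1 < s) (hs' : s < d)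
    (q : ℝ) (hq : q < 0) :
    -- behaviour of `f` on `(0,1)`
    (StrictAntiOn (RieszSphere.f d s) (Ioo 0 1) ∧
      (∀ R ∈ Ioo (0 : ℝ) 1, -RieszSphere.W d s ≤ RieszSphere.f d s R ∧ RieszSphere.f d s R ≤ 0) ∧
      ¬ ConvexOn ℝ (Ioo 0 1) (RieszSphere.f d s) ∧
      ¬ ConcaveOn ℝ (Ioo 0 1) (RieszSphere.f d s)) ∧
    -- the signed equilibrium exists and is unique
    (∀ R ∈ Ico (0 : ℝ) 1, ∃! η : SignedMeasure (RieszSphere.Sph d),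
      RieszSphere.IsSignedEquilibrium s (RieszSphere.field d s q R) η) ∧
    -- weak charges
    (-1 ≤ q →
      (∀ R ∈ Ioo (0 : ℝ) 1, ∀ η : SignedMeasure (RieszSphere.Sph d),
        RieszSphere.IsSignedEquilibrium s (RieszSphere.field d s q R) η →
          0 ≤ η ∧ RieszSphere.HasFullSupport η) ∧
      (∀ R ∈ Ioo (0 : ℝ) 1, ¬ RieszSphere.IsCriticalDistance d s q R) ∧
      (∀ ρ : ℝ, ¬ RieszSphere.IsGoncharSolution d s q ρ)) ∧
    -- strong charges
    (q < -1 → ∃ Rq ∈ Ioo (0 : ℝ) 1,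
      (∀ R ∈ Ioo (0 : ℝ) 1, RieszSphere.goncharD d s q R = 0 ↔ R = Rq) ∧
      (∀ R ∈ Ioo (0 : ℝ) 1, ∀ η : SignedMeasure (RieszSphere.Sph d),
        RieszSphere.IsSignedEquilibrium s (RieszSphere.field d s q R) η →
          (0 ≤ η ↔ R ≤ Rq) ∧ (R ≤ Rq → RieszSphere.HasFullSupport η)) ∧
      (∀ R ∈ Ioo (0 : ℝ) 1, RieszSphere.IsCriticalDistance d s q R ↔ R = Rq) ∧
      (∀ ρ : ℝ, RieszSphere.IsGoncharSolution d s q ρ ↔ ρ = 1 - Rq)) ∧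
    -- the trivial position of the charge at the center
    ((∀ η : SignedMeasure (RieszSphere.Sph d),
        RieszSphere.IsSignedEquilibrium s (RieszSphere.field d s q 0) η →
          0 ≤ η ∧ RieszSphere.HasFullSupport η) ∧
      ¬ RieszSphere.DensityVanishesAtSouthPole d s q 0) := by
  have hs0 : 0 < s := by
    have : (1 : ℝ) ≤ d := by exact_mod_cast hd
    linarith
  have hW := RieszSphere.W_pos hd hs0 hs hs'
  have hanti := RieszSphere.strictAntiOn_f hd hs0 hs hs'
  have h0 : (0 : ℝ) ∈ Icc (0 : ℝ) 1 := left_mem_Icc.2 zero_le_one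
  have h1 : (1 : ℝ) ∈ Icc (0 : ℝ) 1 := right_mem_Icc.2 zero_le_one
  have hf0 := RieszSphere.f_zero hd s
  have hf1 : RieszSphere.f d s 1 = -RieszSphere.W d s := by rw [RieszSphere.f_one hs', RieszSphere.W_eq hd hs0]
  have hIcc : ∀ R ∈ Ioo (0 : ℝ) 1, R ∈ Icc (0 : ℝ) 1 := fun R hR ↦ ⟨hR.1.le, hR.2.le⟩
  have hgt : ∀ R ∈ Ioo (0 : ℝ) 1, -RieszSphere.W d s < RieszSphere.f d s R := fun R hR ↦
    hf1 ▸ hanti (hIcc R hR) h1 hR.2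
  have hsol : ∀ ρ, RieszSphere.IsGoncharSolution d s q ρ ↔
      ∃ R ∈ Ioo (0 : ℝ) 1, ρ = 1 - R ∧ RieszSphere.W d s / q = RieszSphere.f d s R := by
    intro ρ
    refine exists_congr fun R ↦ and_congr_right fun hR ↦ ?_
    rw [RieszSphere.dist_smul_axis_axis hR.2.le,
      RieszSphere.densityVanishesAtSouthPole_iff_f hd hs0 hs hs' hq ⟨hR.1.le, hR.2⟩]
  have hcrit : ∀ R ∈ Ioo (0 : ℝ) 1, RieszSphere.IsCriticalDistance d s q R ↔
      RieszSphere.W d s / q = RieszSphere.f d s R := fun R hR ↦ and_iff_right (Or.inl hR)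
  have hpos := fun (R : ℝ) (hR : R ∈ Ioo (0 : ℝ) 1) (η : SignedMeasure (RieszSphere.Sph d))
    (hη : RieszSphere.IsSignedEquilibrium s (RieszSphere.field d s q R) η) ↦
    hη.nonneg_iff hd hs0 hs hs' hq hR
  refine ⟨⟨hanti.mono Ioo_subset_Icc_self, fun R hR ↦ ⟨(hgt R hR).le, ?_⟩,
    RieszSphere.not_convexOn_f hd hs0 hs hs', RieszSphere.not_concaveOn_f hd hs0 hs hs'⟩, fun R hR ↦
    ⟨_, RieszSphere.isSignedEquilibrium_eqDensity hd hs0 hs hs' hR, fun η hη ↦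
      hη.eq_withDensityᵥ hd hs0 hs hs' hR⟩, fun hq1 ↦ ?_, fun hq1 ↦ ?_, ?_, ?_⟩
  · exact (hf0 ▸ hanti h0 (hIcc R hR) hR.1).le
  -- For `-1 ≤ q < 0` the level satisfies `W / q ≤ -W`, which `f` only reaches at the excluded
  -- endpoint `R = 1`.
  · have hlt : ∀ R ∈ Ioo (0 : ℝ) 1, RieszSphere.W d s / q < RieszSphere.f d s R := fun R hR ↦ by
      refine lt_of_le_of_lt ?_ (hgt R hR)
      rw [div_le_iff_of_neg hq]
      nlinarith
    refine ⟨fun R hR η hη ↦ ?_, fun R hR h ↦ (hlt R hR).ne ((hcrit R hR).1 h), fun ρ h ↦ ?_⟩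
    · have := hpos R hR η hη
      exact ⟨this.1.2 (hlt R hR).le, this.2 (hlt R hR).le⟩
    · obtain ⟨R, hR, -, h⟩ := (hsol ρ).1 h
      exact (hlt R hR).ne h
  -- For `q < -1` the level lies strictly between the end values of `f`, so it is attained, and by
  -- strict monotonicity only once.
  · have hmem : RieszSphere.W d s / q ∈ Ioo (RieszSphere.f d s 1) (RieszSphere.f d s 0) := by
      rw [hf0, hf1]
      refine ⟨?_, div_neg_of_pos_of_neg hW hq⟩
      rw [lt_div_iff_of_neg hq]
      nlinarith
    obtain ⟨Rq, hRq, hfRq⟩ := intermediate_value_Ioo' zero_le_one (RieszSphere.continuousOn_f hd hs0 hs') hmem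
    have hiff : ∀ R ∈ Ioo (0 : ℝ) 1, RieszSphere.W d s / q = RieszSphere.f d s R ↔ R = Rq :=
      fun R hR ↦ by rw [← hfRq, eq_comm, hanti.injOn.eq_iff (hIcc R hR) (hIcc Rq hRq)]
    have hle : ∀ R ∈ Ioo (0 : ℝ) 1, RieszSphere.W d s / q ≤ RieszSphere.f d s R ↔ R ≤ Rq :=
      fun R hR ↦ by rw [← hfRq, hanti.le_iff_ge (hIcc Rq hRq) (hIcc R hR)]
    refine ⟨Rq, hRq, fun R hR ↦ (RieszSphere.goncharD_eq_zero_iff hR).trans (hiff R hR), fun R hR η hη ↦ ?_,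
      fun R hR ↦ (hcrit R hR).trans (hiff R hR), fun ρ ↦ ?_⟩
    · rw [← hle R hR]
      exact hpos R hR η hη
    · rw [hsol]
      refine ⟨?_, fun h ↦ ⟨Rq, hRq, h, hfRq.symm⟩⟩
      rintro ⟨R, hR, rfl, h⟩
      rw [(hiff R hR).1 h]
  · intro η hη
    rw [hη.eq_withDensityᵥ hd hs0 hs hs' ⟨le_rfl, one_pos⟩]
    have hcont : Continuous (RieszSphere.eqDensity d s q 0) := RieszSphere.continuous_eqDensity (by norm_num)
    have hp : ∀ y, 0 < RieszSphere.eqDensity d s q 0 y := fun y ↦ by rw [RieszSphere.eqDensity_zero hd]; exact one_pos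
    exact ⟨RieszSphere.withDensityᵥ_nonneg hcont fun y ↦ (hp y).le,
      RieszSphere.hasFullSupport_withDensityᵥ hd hcont (x := RieszSphere.southPole d) (hp _).le fun y _ ↦ hp y⟩
  · rw [RieszSphere.densityVanishesAtSouthPole_iff hd hs0 hs hs' ⟨le_rfl, one_pos⟩, RieszSphere.eqDensity_zero hd]
    exact one_ne_zero
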